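/- Setting. Let $D\subseteq\mathbb R$ be an interval with $0\in D$, let $\psi:D\to\mathbb R$ be measurable and a.e. positive, let $\omega$ be a probability density on $D$, and let $\kappa:D\times D\to\mathbb R$ be measurable with $\kappa(0,\cdot)\equiv0$. Write $p^*$ for the conjugate exponent of $p\in[1,\infty]$ (and $1/\infty=0$). Let $s\in\mathbb N$ or $s=\infty$, let $[s]=\{1,\dots,s\}$ ($[\infty]=\mathbb N$), and let $u,v$ denote finite subsets of $[s]$. Put $\psi_u(t)=\prod_{j\in u}\psi(t_j)$ and let $L_{u,p,\psi}$ be the $L_p$ space of real functions on $D^{u}$ with respect to $\psi_u(t)\,dt$ (constants with the absolute value if $u=\emptyset$). For a kernel $k$ on $D\times D$ let $$K_u^{k}(g)(x)=\int_{D^{u}}g(t)\prod_{j\in u}k(x_j,t_j)\,dt .$$ Put $$\widehat\kappa_p(x)=\Big\|\frac{|\kappa(x,\cdot)|}{\psi^{1/p}}\Big\|_{L_{p^*}(D)},\qquad \overline\kappa_{p,\omega}(t)=\int_D\frac{|\kappa(x,t)|}{\psi^{1/p}(t)}\,\omega(x)\,dx,\qquad \kappa_\omega(x,t)=\kappa(x,t)-\int_D\kappa(y,t)\,\omega(y)\,dy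 .$$ Let $\gamma=(\gamma_u)$ be nonnegative weights such that $\gamma_u>0$ implies $\gamma_v>0$ for all $v\subseteq u$. For $p_1,p_2\in[1,\infty]$, the anchored space $\mathcal F_{s,p_1,p_2,\gamma}$ consists of the functions $f=\sum_{u}K^{\kappa}_u(g_u)$ on $D^s$ with $g_u\in L_{u,p_1,\psi}$, with norm $$\|f\|=\Big(\sum_u\gamma_u^{-p_2}\|g_u\|_{L_{u,p_1,\psi}}^{p_2}\Big)^{1/p_2}<\infty$$ ($\sup_u\gamma_u^{-1}\|g_u\|_{L_{u,p_1,\psi}}$ if $p_2=\infty$; $g_u=0$ whenever $\gamma_u=0$). The unanchored space $\mathcal F_{s,p_1,p_2,\gamma,\omega}$ is defined in the same way with $\kappa_\omega$ in place of $\kappa$. For $s=\infty$ the spaces are the completions of the normed spaces of finite sums. Let $\|\imath_{p_1,p_2}\|\in[0,\infty]$ be the norm of the embedding $\imath_{p_1,p_2}:\mathcal F_{s,p_1,p_2,\gamma}\to\mathcal F_{s,p_1,p_2,\gamma,\omega}$, $\imath_{p_1,p_2}(f)=f$ (for $s=\infty$, of its continuous extension from the finite sums; the norm is $\infty$ if there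 is no bounded embedding). Corollary. Suppose that $\|\overline\kappa_{p,\omega}\|_{L_{p^*}(D)}<\infty$ for every $p\in[1,\infty]$, let $p_1,p_2\in[1,\infty]$, and suppose that for each $p\in\{1,p_1,\infty\}$ one has $\widehat\kappa_p(x)<\infty$ for all $x\in D$ and, for every nonempty $u$, the operator $K^\kappa_u$ is injective on $L_{u,p,\psi}$. If $p_1\le p_2$, then $$\|\imath_{p_1,p_2}\|\le\|\imath_{1,\infty}\|^{1/p_1-1/p_2}\,\|\imath_{1,1}\|^{1/p_2}\,\|\imath_{\infty,\infty}\|^{1-1/p_1},$$ and if $p_2<p_1$, then $$\|\imath_{p_1,p_2}\|\le\|\imath_{\infty,1}\|^{1/p_2-1/p_1}\,\|\imath_{1,1}\|^{1/p_1}\,\|\imath_{\infty,\infty}\|^{1-1/p_2}.$$ If moreover the weights are product weights, $\gamma_u=\prod_{j\in u}\gamma_j$ with $\gamma_j\ge0$, then $$\|\imath_{p_1,p_2}\|\le\prod_{j=1}^s\big(1+\gamma_j\|\overline\kappa_{1,\omega}\|_{L_\infty}\big)^{1/p_1}\big(1+\gamma_j\|\overline\kappa_{\infty,\omega}\|_{L_1}\big)^{1-1/p_1}.$$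 (Norms and products may be $\infty$ when $s=\infty$; here $\infty^0=1$.) -/

import Mathlib

open MeasureTheory Filter
open scoped ENNReal NNReal

attribute [local instance] Measure.Subtype.measureSpace

noncomputable section

namespace WeightedSpaces

/-- The coordinates `[s]` of `D ^ s`, numbered from `0`; `s = ⊤` means infinitely many variables. -/
abbrev Coord (s : ℕ∞) : Type := {j : ℕ // (j : ℕ∞) < s}

variable {D : Set ℝ} {ι : Type}

/-- The measure `ψ_u(t) dt` on `D ^ u`, with `ψ_u(t) = ∏_{j ∈ u} ψ(t_j)`. Then `L_{u,p,ψ}` is the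
`L^p` space of this measure. For `u = ∅` it is the unit mass at a point, so that `L_{∅,p,ψ}` is the
space of constants with the absolute value as its norm. -/
def weightMeasure (ψ : D → ℝ) (u : Finset ι) : Measure (u → D) :=
  (volume : Measure (u → D)).withDensity fun t => ENNReal.ofReal (∏ j, ψ (t j))

/-- `κ̂_p(x)`, the `L^{p*}(D)` norm of `t ↦ |κ(x,t)| / ψ(t)^{1/p}`. -/
def kappaHat (ψ : D → ℝ) (κ : D → D → ℝ) (p : ℝ≥0∞) (x : D) : ℝ≥0∞ :=
  eLpNorm (fun t => |κ x t| / ψ t ^ (p⁻¹).toReal) p.conjExponent volume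

/-- `κ̄_{p,ω}(t) = ∫_D |κ(x,t)| / ψ(t)^{1/p} ω(x) dx`, with values in `[0,∞]`. -/
def kappaBar (ψ ω : D → ℝ) (κ : D → D → ℝ) (p : ℝ≥0∞) (t : D) : ℝ≥0∞ :=
  ∫⁻ x, ENNReal.ofReal (|κ x t| / ψ t ^ (p⁻¹).toReal * ω x)

/-- `‖κ̄_{p,ω}‖_{L_{p*}}`. -/
def kappaBarNorm (ψ ω : D → ℝ) (κ : D → D → ℝ) (p : ℝ≥0∞) : ℝ≥0∞ :=
  eLpNorm (kappaBar ψ ω κ p) p.conjExponent volume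

/-- The integral operator on `D ^ u` with kernel `∏_{j ∈ u} k(x_j,t_j)`. -/
def K (k : D → D → ℝ) (u : Finset ι) (g : (u → D) → ℝ) (x : u → D) : ℝ :=
  ∫ t : u → D, g t * ∏ j, k (x j) (t j)

/-- The univariate kernel `κ(x,t) - I(κ(·,t))` of the unanchored space, where
`I(f) = ∫_D f(y) ω(y) dy`. -/
def centered (ω : D → ℝ) (κ : D → D → ℝ) (x t : D) : ℝ :=
  κ x t - ∫ y, κ y t * ω y

/-- `(∑_u γ_u^{-p₂} ‖g_u‖_{L_{u,p₁,ψ}}^{p₂})^{1/p₂}`, and `sup_u γ_u^{-1} ‖g_u‖_{L_{u,p₁,ψ}}` for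
`p₂ = ∞`. In `[0,∞]` one has `0⁻¹ = ∞` and `∞ * 0 = 0`, so a vanishing weight `γ_u` forces
`g_u = 0` wherever this is finite. -/
def coeffNorm (ψ : D → ℝ) (γ : Finset ι → ℝ≥0) (p₁ p₂ : ℝ≥0∞)
    (g : ∀ u : Finset ι, (u → D) → ℝ) : ℝ≥0∞ :=
  if p₂ = ∞ then ⨆ u, (γ u : ℝ≥0∞)⁻¹ * eLpNorm (g u) p₁ (weightMeasure ψ u)
  else (∑' u, ((γ u : ℝ≥0∞)⁻¹ * eLpNorm (g u) p₁ (weightMeasure ψ u)) ^ p₂.toReal) ^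
    (1 / p₂.toReal)

/-- `f = ∑_u K_u(g_u)` everywhere on `D ^ ι`, where `g_u ∈ L_{u,p₁,ψ}` and only finitely many `g_u`
are nonzero (no restriction if there are finitely many variables). -/
def Represents (k : D → D → ℝ) (ψ : D → ℝ) (p₁ : ℝ≥0∞) (f : (ι → D) → ℝ)
    (g : ∀ u : Finset ι, (u → D) → ℝ) : Prop :=
  (∀ u, MemLp (g u) p₁ (weightMeasure ψ u)) ∧
  ∃ A : Finset (Finset ι), (∀ u, u ∉ A → g u = 0) ∧
    ∀ x : ι → D, f x = ∑ u ∈ A, K k u (g u) fun j => x j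

/-- The norm of `f = ∑_u K_u(g_u)` in the weighted space built from the kernel `k`; it is `∞` if `f`
is not (a finite sum of components) in the space. When the operators are injective, the `g_u` are
unique up to null sets and the infimum is over equal values. -/
def spaceNorm (k : D → D → ℝ) (ψ : D → ℝ) (γ : Finset ι → ℝ≥0) (p₁ p₂ : ℝ≥0∞)
    (f : (ι → D) → ℝ) : ℝ≥0∞ :=
  ⨅ (g : ∀ u : Finset ι, (u → D) → ℝ) (_ : Represents k ψ p₁ f g), coeffNorm ψ γ p₁ p₂ g

/-- `f` is a Cauchy sequence in the space `{h | N h < ∞}` normed by `N`. -/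
def IsCauchyFor {X : Type} (N : (X → ℝ) → ℝ≥0∞) (f : ℕ → X → ℝ) : Prop :=
  (∀ n, N (f n) < ∞) ∧ ∀ ε : ℝ≥0∞, 0 < ε → ∃ n₀, ∀ m ≥ n₀, ∀ n ≥ n₀, N (f m - f n) ≤ ε

/-- The norm, in `[0,∞]`, of the embedding `f ↦ f` of the completion of the space normed by `M` into
the completion of the space normed by `N`: elements of the completions are given by Cauchy sequences
`(f_n)`, the norm of such an element being the limit of the norms of the `f_n`. It is `∞` if there
is no bounded embedding. -/
def embeddingNorm {X : Type} (M N : (X → ℝ) → ℝ≥0∞) : ℝ≥0∞ :=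
  sInf {C : ℝ≥0∞ | ∀ f : ℕ → X → ℝ, IsCauchyFor M f →
    IsCauchyFor N f ∧
      limsup (fun n => N (f n)) atTop ≤ C * limsup (fun n => M (f n)) atTop}

/-- `‖ı_{p₁,p₂}‖`, the norm of the embedding of the anchored space (kernel `κ`) into the
unanchored space (kernel `κ(x,t) - I(κ(·,t))`). With finitely many variables both spaces are
already complete; with infinitely many they are the completions of the spaces of finite sums. -/
def embNorm (ψ ω : D → ℝ) (κ : D → D → ℝ) (γ : Finset ι → ℝ≥0) (p₁ p₂ : ℝ≥0∞) : ℝ≥0∞ :=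
  embeddingNorm (spaceNorm κ ψ γ p₁ p₂) (spaceNorm (centered ω κ) ψ γ p₁ p₂)

/-- The standing assumptions on the kernel for the integrability exponent `p`, with variables in
`ι`: `κ̂_p` is finite everywhere, and each `K_u` is injective on `L_{u,p,ψ}`. -/
structure Admissible (ι : Type) (ψ : D → ℝ) (κ : D → D → ℝ) (p : ℝ≥0∞) : Prop where
  kappaHat_lt_top : ∀ x, kappaHat ψ κ p x < ∞
  injective : ∀ (u : Finset ι) (g : (u → D) → ℝ), u.Nonempty → MemLp g p (weightMeasure ψ u) →
    (∀ x, K κ u g x = 0) → g =ᵐ[volume] 0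

end WeightedSpaces

end

/-! Put μ = ψ dt, b(t) = ∫ κ(y,t) ω(y) dy and β = b/ψ, so that κ = κ_ω + b. Expanding the product of
these sums over the coordinates in u turns K^κ_u(g_u) into the sum over v ⊆ u of K^{κ_ω}_v applied
to g_u with the coordinates in u \ v integrated out against β (`represents_transform`). On
components the embedding is thus a triangular operator. Integrating out one coordinate costs at most
‖β‖_∞^{1/p₁} ‖β‖_1^{1-1/p₁} in L^{p₁}(μ), so the embedding is dominated by the nonnegative matrix
`amp` acting on ℓ^{p₂} (`coeffNorm_transform_le`). This matrix is the entrywise product B^{1/p₁}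
C^{1-1/p₁}, where B and C belong to p = 1 and p = ∞ (`amp_interpolate`). Hölder's inequality bounds
its norm by powers of the row and column sums of B and C (`seqNorm_matrix_le_of_le`,
`seqNorm_matrix_le_of_lt`).

These sums are in turn lower bounds for the endpoint embedding norms (`IsShift.rowSum_amp_le`,
`IsShift.colSum_amp_le`). The test functions are tensor powers of a χ of unit norm for which ∫ χβ dμ
approaches ‖β‖_∞ (p = 1) or equals ‖β‖_1 (p = ∞). The lower bounds need the components in the
unanchored space to be unique; `Represents.ae_eq_zero` derives this from the anchored space.

For product weights the row and column sums are at most ∏(1 + γ_j m), with m = ‖β‖_∞ or ‖β‖_1, and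
these are bounded by the norms of κ̄_{1,ω} and κ̄_{∞,ω}. -/

noncomputable section

namespace WeightedSpaces

/-! ### Splitting a finite power and integrating out coordinates. -/

section PartialIntegration

variable {ι : Type} [DecidableEq ι] {Ω : Type*}

lemma prod_subtype_sdiff {R : Type*} [CommMonoid R] {u v : Finset ι} (h : v ⊆ u) (G : u → R) :
    ∏ j, G j = (∏ j : v, G ⟨j, h j.2⟩) * ∏ j : ↥(u \ v), G ⟨j, (Finset.mem_sdiff.1 j.2).1⟩ := by
  have hu : ∏ j, G j = ∏ j ∈ u, if hj : j ∈ u then G ⟨j, hj⟩ else 1 := by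
    rw [← Finset.prod_coe_sort u]
    exact Finset.prod_congr rfl fun j _ => by simp
  have hv : ∏ j : v, G ⟨j, h j.2⟩ = ∏ j ∈ v, if hj : j ∈ u then G ⟨j, hj⟩ else 1 := by
    rw [← Finset.prod_coe_sort v]
    exact Finset.prod_congr rfl fun j _ => by simp [h j.2]
  have hw : ∏ j : ↥(u \ v), G ⟨j, (Finset.mem_sdiff.1 j.2).1⟩ =
      ∏ j ∈ u \ v, if hj : j ∈ u then G ⟨j, hj⟩ else 1 := by
    rw [← Finset.prod_coe_sort (u \ v)]
    exact Finset.prod_congr rfl fun j _ => by simp [(Finset.mem_sdiff.1 j.2).1]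
  rw [hu, hv, hw, mul_comm, Finset.prod_sdiff h]

/-- The point of `Ω ^ u` with coordinates `t` in `v` and `s` in `u \ v`. -/
def glue {u v : Finset ι} (t : v → Ω) (s : ↥(u \ v) → Ω) : u → Ω := fun j =>
  if hj : (j : ι) ∈ v then t ⟨j, hj⟩ else s ⟨j, Finset.mem_sdiff.2 ⟨j.2, hj⟩⟩

lemma glue_of_mem {u v : Finset ι} (t : v → Ω) (s : ↥(u \ v) → Ω) (j : v) (hj : (j : ι) ∈ u) :
    glue t s ⟨j, hj⟩ = t j := by
  simp [glue]

lemma glue_of_mem_sdiff {u v : Finset ι} (t : v → Ω) (s : ↥(u \ v) → Ω) (j : ↥(u \ v))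
    (hj : (j : ι) ∈ u) : glue t s ⟨j, hj⟩ = s j := by
  simp [glue, (Finset.mem_sdiff.1 j.2).2]

lemma prod_glue {R : Type*} [CommMonoid R] {u v : Finset ι} (h : v ⊆ u) (F : ι → Ω → R)
    (t : v → Ω) (s : ↥(u \ v) → Ω) :
    ∏ j : u, F j (glue t s j) = (∏ j : v, F j (t j)) * ∏ j : ↥(u \ v), F j (s j) := by
  rw [prod_subtype_sdiff h]
  congr 1
  · exact Finset.prod_congr rfl fun j _ => by rw [glue_of_mem]
  · exact Finset.prod_congr rfl fun j _ => by rw [glue_of_mem_sdiff]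

lemma prod_add_glue {R : Type*} [CommSemiring R] (u : Finset ι) (F G : ι → Ω → R) (t : u → Ω) :
    ∏ j : u, (F j (t j) + G j (t j)) = ∑ v ∈ u.powerset.attach,
      (∏ j : ↥v.1, F j (t ⟨j, Finset.mem_powerset.1 v.2 j.2⟩)) *
        ∏ j : ↥(u \ v.1), G j (t ⟨j, (Finset.mem_sdiff.1 j.2).1⟩) := by
  let F' : ι → R := fun j => if hj : j ∈ u then F j (t ⟨j, hj⟩) else 1
  let G' : ι → R := fun j => if hj : j ∈ u then G j (t ⟨j, hj⟩) else 1
  have h1 : ∏ j : u, (F j (t j) + G j (t j)) = ∏ j ∈ u, (F' j + G' j) := by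
    rw [← Finset.prod_coe_sort u]
    exact Finset.prod_congr rfl fun j _ => by simp [F', G']
  rw [h1, Finset.prod_add, ← Finset.sum_attach]
  refine Finset.sum_congr rfl fun v _ => ?_
  have hv := Finset.mem_powerset.1 v.2
  congr 1
  · rw [← Finset.prod_coe_sort v.1]
    exact Finset.prod_congr rfl fun j _ => by simp [F', hv j.2]
  · rw [← Finset.prod_coe_sort (u \ v.1)]
    exact Finset.prod_congr rfl fun j _ => by simp [G', (Finset.mem_sdiff.1 j.2).1]

variable [MeasurableSpace Ω] {μ : Measure Ω} [SigmaFinite μ]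

lemma measurable_glue {u v : Finset ι} :
    Measurable fun z : (v → Ω) × (↥(u \ v) → Ω) => (glue z.1 z.2 : u → Ω) := by
  refine measurable_pi_iff.2 fun j => ?_
  by_cases hj : (j : ι) ∈ v
  · simp only [glue, hj, dif_pos]
    fun_prop
  · simp only [glue, hj]
    exact (measurable_pi_apply _).comp measurable_snd

lemma measurePreserving_glue {u v : Finset ι} (h : v ⊆ u) :
    MeasurePreserving (fun z : (v → Ω) × (↥(u \ v) → Ω) => (glue z.1 z.2 : u → Ω))
      ((Measure.pi fun _ => μ).prod (Measure.pi fun _ => μ)) (Measure.pi fun _ => μ) := by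
  refine ⟨measurable_glue, (Measure.pi_eq fun s hs => ?_).symm⟩
  rw [Measure.map_apply measurable_glue (MeasurableSet.univ_pi hs)]
  have : (fun z : (v → Ω) × (↥(u \ v) → Ω) => (glue z.1 z.2 : u → Ω)) ⁻¹' Set.univ.pi s =
      (Set.univ.pi fun j : v => s ⟨j, h j.2⟩) ×ˢ
        (Set.univ.pi fun j : ↥(u \ v) => s ⟨j, (Finset.mem_sdiff.1 j.2).1⟩) := by
    ext z
    simp only [Set.mem_preimage, Set.mem_pi, Set.mem_univ, forall_const, Set.mem_prod]
    constructor
    · intro H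
      exact ⟨fun j => by simpa [glue_of_mem] using H ⟨j, h j.2⟩,
        fun j => by simpa [glue_of_mem_sdiff] using H ⟨j, (Finset.mem_sdiff.1 j.2).1⟩⟩
    · rintro ⟨H1, H2⟩ j
      by_cases hj : (j : ι) ∈ v
      · simpa [glue, hj] using H1 ⟨j, hj⟩
      · simpa [glue, hj] using H2 ⟨j, Finset.mem_sdiff.2 ⟨j.2, hj⟩⟩
  rw [this, Measure.prod_prod, Measure.pi_pi, Measure.pi_pi, prod_subtype_sdiff h]

/-- The integral of `g` against `∏ β(t_j)` over the coordinates in `u \ v`. -/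
def partialIntegral (μ : Measure Ω) (β : Ω → ℝ) (v u : Finset ι) (g : (u → Ω) → ℝ)
    (t : v → Ω) : ℝ :=
  ∫ s : ↥(u \ v) → Ω, g (glue t s) * ∏ j, β (s j) ∂Measure.pi fun _ => μ

omit [SigmaFinite μ] in
lemma partialIntegral_self (β : Ω → ℝ) (u : Finset ι) (g : (u → Ω) → ℝ) :
    partialIntegral μ β u u g = g := by
  ext t
  have : IsEmpty ↥(u \ u) := ⟨fun j => by simpa using j.2⟩
  have hg : ∀ s : ↥(u \ u) → Ω, glue t s = t := fun s => by ext j; simp [glue]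
  simp [partialIntegral, hg, Measure.real]

/-- Each coordinate integrated out of a tensor power contributes one scalar factor ∫ χβ. The lower
bounds on the embedding norms rest on this exact formula. -/
lemma partialIntegral_prod {u v : Finset ι} (h : v ⊆ u) (β χ : Ω → ℝ) (a : ℝ) (t : v → Ω) :
    partialIntegral μ β v u (fun t => a * ∏ j, χ (t j)) t =
      (a * (∫ x, χ x * β x ∂μ) ^ (u \ v).card) * ∏ j, χ (t j) := by
  unfold partialIntegral
  simp only [prod_glue h fun _ => χ]
  have : ∀ s : ↥(u \ v) → Ω, a * ((∏ j, χ (t j)) * ∏ j, χ (s j)) * ∏ j, β (s j) =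
      (a * ∏ j, χ (t j)) * ∏ j, (χ (s j) * β (s j)) := fun s => by
    rw [Finset.prod_mul_distrib]; ring
  simp only [this]
  rw [integral_const_mul, integral_fintype_prod_eq_prod (fun _ x => χ x * β x)]
  simp only [Finset.prod_const, Finset.card_univ, Fintype.card_coe]
  ring

lemma aestronglyMeasurable_prod_pi {δ : Type*} [Fintype δ] {b : δ → Ω → ℝ}
    (hb : ∀ j, AEStronglyMeasurable (b j) μ) :
    AEStronglyMeasurable (fun t : δ → Ω => ∏ j, b j (t j)) (Measure.pi fun _ => μ) := by
  refine Finset.aestronglyMeasurable_fun_prod _ fun j _ => ?_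
  exact (hb j).comp_quasiMeasurePreserving (Measure.quasiMeasurePreserving_eval (fun _ => μ) j)

lemma eLpNorm_top_prod_pi_le {δ : Type*} [Fintype δ] (b : δ → Ω → ℝ) :
    eLpNorm (fun t : δ → Ω => ∏ j, b j (t j)) ∞ (Measure.pi fun _ => μ) ≤
      ∏ j, eLpNorm (b j) ∞ μ := by
  rw [eLpNorm_exponent_top]
  refine essSup_le_of_ae_le _ ?_
  have : ∀ j, ∀ᵐ t : δ → Ω ∂Measure.pi fun _ => μ, ‖b j (t j)‖ₑ ≤ eLpNorm (b j) ∞ μ := fun j => by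
    refine (Measure.quasiMeasurePreserving_eval (fun _ => μ) j).ae (p := fun x =>
      ‖b j x‖ₑ ≤ eLpNorm (b j) ∞ μ) ?_
    rw [eLpNorm_exponent_top]
    exact ae_le_eLpNormEssSup
  filter_upwards [ae_all_iff.2 this] with t ht
  simp only [enorm_eq_nnnorm, nnnorm_prod, ENNReal.ofNNReal_finsetProd] at ht ⊢
  exact Finset.prod_le_prod' fun j _ => ht j

lemma eLpNorm_one_prod_pi {δ : Type*} [Fintype δ] {b : δ → Ω → ℝ}
    (hb : ∀ j, Integrable (b j) μ) :
    eLpNorm (fun t : δ → Ω => ∏ j, b j (t j)) 1 (Measure.pi fun _ => μ) =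
      ∏ j, eLpNorm (b j) 1 μ := by
  simp only [eLpNorm_one_eq_lintegral_enorm]
  rw [← ofReal_integral_norm_eq_lintegral_enorm (Integrable.fintype_prod hb)]
  simp only [norm_prod]
  rw [integral_fintype_prod_eq_prod (fun j x => ‖b j x‖),
    ENNReal.ofReal_prod_of_nonneg fun j _ => integral_nonneg fun _ => norm_nonneg _]
  exact Finset.prod_congr rfl fun j _ => ofReal_integral_norm_eq_lintegral_enorm (hb j)

lemma memLp_prod_pi {δ : Type*} [Fintype δ] {b : δ → Ω → ℝ} {q : ℝ≥0∞}
    (hb : ∀ j, MemLp (b j) q μ) (hq : 1 ≤ q) :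
    MemLp (fun t : δ → Ω => ∏ j, b j (t j)) q (Measure.pi fun _ => μ) := by
  have hm := aestronglyMeasurable_prod_pi fun j => (hb j).1
  by_cases hq' : q = ∞
  · subst hq'
    refine ⟨hm, (eLpNorm_top_prod_pi_le b).trans_lt ?_⟩
    exact ENNReal.prod_lt_top fun j _ => (hb j).2
  · have hq0 : q ≠ 0 := (zero_lt_one.trans_le hq).ne'
    rw [← integrable_norm_rpow_iff hm hq0 hq']
    have := Integrable.fintype_prod (μ := fun _ : δ => μ)
      fun j => (integrable_norm_rpow_iff (hb j).1 hq0 hq').2 (hb j)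
    refine this.congr (Eventually.of_forall fun t => ?_)
    simp only [norm_prod]
    exact Real.finsetProd_rpow _ _ (fun j _ => norm_nonneg _) _

lemma aestronglyMeasurable_partialIntegral {u v : Finset ι} (h : v ⊆ u) {β : Ω → ℝ}
    (hβ : AEStronglyMeasurable β μ) {g : (u → Ω) → ℝ}
    (hg : AEStronglyMeasurable g (Measure.pi fun _ => μ)) :
    AEStronglyMeasurable (partialIntegral μ β v u g) (Measure.pi fun _ => μ) := by
  have h1 : AEStronglyMeasurable (fun z : (v → Ω) × (↥(u \ v) → Ω) =>
      g (glue z.1 z.2) * ∏ j, β (z.2 j))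
      ((Measure.pi fun _ => μ).prod (Measure.pi fun _ => μ)) :=
    (hg.comp_measurePreserving (measurePreserving_glue h)).mul
      (aestronglyMeasurable_prod_pi fun _ => hβ).comp_snd
  exact h1.integral_prod_right'

end PartialIntegration

lemma toReal_inv_le_one {p : ℝ≥0∞} (hp : 1 ≤ p) : (p⁻¹).toReal ≤ 1 := by
  simpa using ENNReal.toReal_mono ENNReal.one_ne_top (ENNReal.inv_le_one.2 hp)

/-! ### L^p bounds for partial integration; expansion of product kernels. -/

section PartialIntegration

/-- For finite p, the inner integral is at most an L^1 norm for the measure |B| dν. Passing to L^p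
costs its total mass to the power 1 - 1/p, and replacing the density |B| by its essential supremum
costs the power 1/p. -/
lemma eLpNorm_integral_mul_le {X Y : Type*} [MeasurableSpace X] [MeasurableSpace Y]
    {ρ : Measure X} {ν : Measure Y} [SFinite ρ] [SFinite ν] {G : X × Y → ℝ} {B : Y → ℝ}
    {p : ℝ≥0∞} (hp : 1 ≤ p) (hG : AEStronglyMeasurable G (ρ.prod ν))
    (hB : AEStronglyMeasurable B ν) :
    eLpNorm (fun x => ∫ y, G (x, y) * B y ∂ν) p ρ ≤
      eLpNorm B ∞ ν ^ (p⁻¹).toReal * eLpNorm B 1 ν ^ (1 - (p⁻¹).toReal) *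
        eLpNorm G p (ρ.prod ν) := by
  have hpt : ∀ x, ‖∫ y, G (x, y) * B y ∂ν‖ₑ ≤ ∫⁻ y, ‖G (x, y)‖ₑ * ‖B y‖ₑ ∂ν := fun x => by
    refine (enorm_integral_le_lintegral_enorm _).trans_eq ?_
    simp only [enorm_mul]
  by_cases hp' : p = ∞
  · subst hp'
    simp only [ENNReal.inv_top, ENNReal.toReal_zero, ENNReal.rpow_zero, one_mul, sub_zero,
      ENNReal.rpow_one]
    rw [eLpNorm_exponent_top (f := fun x => ∫ y, G (x, y) * B y ∂ν)]
    refine essSup_le_of_ae_le _ ?_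
    have hbd : ∀ᵐ z ∂ρ.prod ν, ‖G z‖ₑ ≤ eLpNorm G ∞ (ρ.prod ν) := by
      rw [eLpNorm_exponent_top]; exact ae_le_eLpNormEssSup
    filter_upwards [Measure.ae_ae_of_ae_prod hbd] with x hx
    refine (hpt x).trans ?_
    rw [mul_comm, eLpNorm_one_eq_lintegral_enorm, ← lintegral_const_mul'' _ hB.enorm]
    refine lintegral_mono_ae ?_
    filter_upwards [hx] with y hy
    gcongr
  · have hp0 : p ≠ 0 := (zero_lt_one.trans_le hp).ne'
    have hq : 1 ≤ p.toReal := by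
      simpa using ENNReal.toReal_mono hp' hp
    have hq0 : 0 < p.toReal := zero_lt_one.trans_le hq
    set q := p.toReal with hqdef
    have hinv : (p⁻¹).toReal = q⁻¹ := ENNReal.toReal_inv p
    set m := eLpNorm B ∞ ν
    set l := eLpNorm B 1 ν with hl
    have key : ∀ᵐ x ∂ρ, ‖∫ y, G (x, y) * B y ∂ν‖ₑ ^ q ≤
        m * (l ^ (1 - q⁻¹)) ^ q * ∫⁻ y, ‖G (x, y)‖ₑ ^ q ∂ν := by
      filter_upwards [hG.prodMk_left] with x hx
      set νB := ν.withDensity fun y => ‖B y‖ₑ with hνB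
      have habs : νB ≪ ν := withDensity_absolutelyContinuous _ _
      have h1 : ∫⁻ y, ‖G (x, y)‖ₑ * ‖B y‖ₑ ∂ν = eLpNorm (fun y => G (x, y)) 1 νB := by
        rw [eLpNorm_one_eq_lintegral_enorm, hνB,
          lintegral_withDensity_eq_lintegral_mul₀ hB.enorm hx.enorm]
        simp [mul_comm]
      have h2 : eLpNorm (fun y => G (x, y)) 1 νB ≤
          eLpNorm (fun y => G (x, y)) p νB * l ^ (1 - q⁻¹) := by
        refine (eLpNorm_le_eLpNorm_mul_rpow_measure_univ hp (hx.mono_ac habs)).trans_eq ?_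
        have : νB Set.univ = l := by
          rw [hνB, withDensity_apply _ MeasurableSet.univ, hl, eLpNorm_one_eq_lintegral_enorm,
            Measure.restrict_univ]
        rw [this]; simp [hqdef]
      have h3 : eLpNorm (fun y => G (x, y)) p νB ^ q ≤ m * ∫⁻ y, ‖G (x, y)‖ₑ ^ q ∂ν := by
        rw [eLpNorm_eq_lintegral_rpow_enorm_toReal hp0 hp', ← ENNReal.rpow_mul,
          one_div_mul_cancel hq0.ne', ENNReal.rpow_one, hνB,
          lintegral_withDensity_eq_lintegral_mul₀ hB.enorm (hx.enorm.pow_const _),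
          ← lintegral_const_mul'' _ (hx.enorm.pow_const _)]
        refine lintegral_mono_ae ?_
        have : ∀ᵐ y ∂ν, ‖B y‖ₑ ≤ m := by
          simp only [m, eLpNorm_exponent_top]; exact ae_le_eLpNormEssSup
        filter_upwards [this] with y hy
        simp only [Pi.mul_apply]
        gcongr
      calc ‖∫ y, G (x, y) * B y ∂ν‖ₑ ^ q
          ≤ (eLpNorm (fun y => G (x, y)) p νB * l ^ (1 - q⁻¹)) ^ q := by
            gcongr
            exact (hpt x).trans (h1.trans_le h2)
        _ = eLpNorm (fun y => G (x, y)) p νB ^ q * (l ^ (1 - q⁻¹)) ^ q :=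
            ENNReal.mul_rpow_of_nonneg _ _ hq0.le
        _ ≤ (m * ∫⁻ y, ‖G (x, y)‖ₑ ^ q ∂ν) * (l ^ (1 - q⁻¹)) ^ q := by gcongr
        _ = _ := by ring
    rw [eLpNorm_eq_lintegral_rpow_enorm_toReal hp0 hp',
      eLpNorm_eq_lintegral_rpow_enorm_toReal hp0 hp', hinv, ← hqdef, one_div]
    have hGm : AEMeasurable (fun z => ‖G z‖ₑ ^ q) (ρ.prod ν) := hG.enorm.pow_const _
    calc (∫⁻ x, ‖∫ y, G (x, y) * B y ∂ν‖ₑ ^ q ∂ρ) ^ q⁻¹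
        ≤ (m * (l ^ (1 - q⁻¹)) ^ q * ∫⁻ z, ‖G z‖ₑ ^ q ∂ρ.prod ν) ^ q⁻¹ := by
          gcongr
          rw [lintegral_prod _ hGm, ← lintegral_const_mul'' _ hGm.lintegral_prod_right']
          exact lintegral_mono_ae key
      _ = _ := by
          rw [ENNReal.mul_rpow_of_nonneg _ _ (by positivity),
            ENNReal.mul_rpow_of_nonneg _ _ (by positivity), ← ENNReal.rpow_mul _ q,
            mul_inv_cancel₀ hq0.ne', ENNReal.rpow_one]

variable {ι : Type} [DecidableEq ι] {Ω : Type*} [MeasurableSpace Ω] {μ : Measure Ω} [SigmaFinite μ]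

/-- The factor by which integrating out one variable against `β` enlarges the `L^p` norm at most. -/
def gain (μ : Measure Ω) (β : Ω → ℝ) (p : ℝ≥0∞) : ℝ≥0∞ :=
  eLpNorm β ∞ μ ^ (p⁻¹).toReal * eLpNorm β 1 μ ^ (1 - (p⁻¹).toReal)

lemma eLpNorm_partialIntegral_le {u v : Finset ι} (h : v ⊆ u) {β : Ω → ℝ} (hβ : Integrable β μ)
    {p : ℝ≥0∞} (hp : 1 ≤ p) {g : (u → Ω) → ℝ}
    (hg : AEStronglyMeasurable g (Measure.pi fun _ => μ)) :
    eLpNorm (partialIntegral μ β v u g) p (Measure.pi fun _ => μ) ≤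
      gain μ β p ^ (u \ v).card * eLpNorm g p (Measure.pi fun _ => μ) := by
  have hG := hg.comp_measurePreserving (measurePreserving_glue (μ := μ) h)
  have hB : AEStronglyMeasurable (fun s : ↥(u \ v) → Ω => ∏ j, β (s j))
      (Measure.pi fun _ => μ) := aestronglyMeasurable_prod_pi fun _ => hβ.1
  have h1p := sub_nonneg.2 (toReal_inv_le_one hp)
  refine (eLpNorm_integral_mul_le hp hG hB).trans ?_
  rw [eLpNorm_comp_measurePreserving hg (measurePreserving_glue h),
    eLpNorm_one_prod_pi fun _ => hβ]
  refine mul_le_mul_left ?_ _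
  have := eLpNorm_top_prod_pi_le (μ := μ) fun _ : ↥(u \ v) => β
  simp only [Finset.prod_const, Finset.card_univ, Fintype.card_coe] at this ⊢
  calc _ ≤ (eLpNorm β ∞ μ ^ (u \ v).card) ^ (p⁻¹).toReal *
        (eLpNorm β 1 μ ^ (u \ v).card) ^ (1 - (p⁻¹).toReal) := by gcongr
    _ = _ := by
      rw [gain, mul_pow]
      congr 1 <;> rw [← ENNReal.rpow_natCast, ← ENNReal.rpow_natCast, ← ENNReal.rpow_mul,
        ← ENNReal.rpow_mul, mul_comm]

omit [SigmaFinite μ] in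
lemma gain_lt_top {β : Ω → ℝ} (hβ : Integrable β μ) (hβ' : MemLp β ∞ μ) {p : ℝ≥0∞}
    (hp : 1 ≤ p) : gain μ β p < ∞ := by
  refine ENNReal.mul_lt_top (ENNReal.rpow_lt_top_of_nonneg ENNReal.toReal_nonneg hβ'.2.ne)
    (ENNReal.rpow_lt_top_of_nonneg (sub_nonneg.2 (toReal_inv_le_one hp)) ?_)
  exact (memLp_one_iff_integrable.2 hβ).2.ne

lemma memLp_partialIntegral {u v : Finset ι} (h : v ⊆ u) {β : Ω → ℝ} (hβ : Integrable β μ)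
    (hβ' : MemLp β ∞ μ) {p : ℝ≥0∞} (hp : 1 ≤ p) {g : (u → Ω) → ℝ}
    (hg : MemLp g p (Measure.pi fun _ => μ)) :
    MemLp (partialIntegral μ β v u g) p (Measure.pi fun _ => μ) :=
  ⟨aestronglyMeasurable_partialIntegral h hβ.1 hg.1,
    (eLpNorm_partialIntegral_le h hβ hp hg.1).trans_lt
      (ENNReal.mul_lt_top (ENNReal.pow_lt_top (gain_lt_top hβ hβ' hp)) hg.2)⟩

lemma partialIntegral_ae_eq_zero {u v : Finset ι} (h : v ⊆ u) {β : Ω → ℝ} (hβ : Integrable β μ)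
    {g : (u → Ω) → ℝ} (hg : g =ᵐ[Measure.pi fun _ => μ] 0) :
    partialIntegral μ β v u g =ᵐ[Measure.pi fun _ => μ] 0 := by
  have hgm : AEStronglyMeasurable g (Measure.pi fun _ => μ) :=
    aestronglyMeasurable_zero.congr hg.symm
  have := eLpNorm_partialIntegral_le h hβ le_rfl hgm
  rw [eLpNorm_congr_ae hg, eLpNorm_zero, mul_zero] at this
  exact (eLpNorm_eq_zero_iff (aestronglyMeasurable_partialIntegral h hβ.1 hgm)
    one_ne_zero).1 (le_antisymm this bot_le)

lemma integrable_mul_prod {δ : Type*} [Fintype δ] {p : ℝ≥0∞} (hp : 1 ≤ p) {g : (δ → Ω) → ℝ}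
    (hg : MemLp g p (Measure.pi fun _ => μ)) {b : δ → Ω → ℝ}
    (hb : ∀ j, MemLp (b j) p.conjExponent μ) :
    Integrable (fun t => g t * ∏ j, b j (t j)) (Measure.pi fun _ => μ) := by
  have := ENNReal.HolderConjugate.conjExponent hp
  exact hg.integrable_mul (memLp_prod_pi hb (by simp [ENNReal.conjExponent]))

omit [SigmaFinite μ] in
lemma memLp_of_integrable_of_memLp_top {β : Ω → ℝ} (hβ : Integrable β μ) (hβ' : MemLp β ∞ μ)
    {q : ℝ≥0∞} (hq : 1 ≤ q) : MemLp β q μ := by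
  by_cases hq' : q = ∞
  · rwa [hq']
  rw [← integrable_norm_rpow_iff hβ.1 (zero_lt_one.trans_le hq).ne' hq']
  have hq1 : 1 ≤ q.toReal := by simpa using ENNReal.toReal_mono hq' hq
  have hm := (hβ.1.aemeasurable.norm.pow_const q.toReal).aestronglyMeasurable
  refine (hβ.norm.const_mul ((eLpNorm β ∞ μ).toReal ^ (q.toReal - 1))).mono' hm ?_
  have : ∀ᵐ x ∂μ, ‖β x‖ₑ ≤ eLpNorm β ∞ μ := by
    rw [eLpNorm_exponent_top]; exact ae_le_eLpNormEssSup
  filter_upwards [this] with x hx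
  have hx' : ‖β x‖ ≤ (eLpNorm β ∞ μ).toReal := by
    simpa using ENNReal.toReal_mono hβ'.2.ne hx
  rw [Real.norm_of_nonneg (by positivity)]
  calc ‖β x‖ ^ q.toReal = ‖β x‖ ^ (q.toReal - 1) * ‖β x‖ := by
        rw [← Real.rpow_add_one' (norm_nonneg _) (by linarith), sub_add_cancel]
    _ ≤ _ := by
        gcongr

/-- Splitting the kernel of an integral operator. -/
lemma integral_mul_prod_add {u : Finset ι} {p : ℝ≥0∞} (hp : 1 ≤ p) {g : (u → Ω) → ℝ}
    (hg : MemLp g p (Measure.pi fun _ => μ)) {b : ι → Ω → ℝ} {β : Ω → ℝ}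
    (hb : ∀ j, MemLp (b j) p.conjExponent μ) (hβ : MemLp β p.conjExponent μ) :
    ∫ t, g t * ∏ j : u, (b j (t j) + β (t j)) ∂(Measure.pi fun _ => μ) =
      ∑ v ∈ u.powerset, ∫ t : v → Ω, partialIntegral μ β v u g t * ∏ j : v, b j (t j)
        ∂(Measure.pi fun _ => μ) := by
  -- The v-th term of the expansion takes b_j on v and β elsewhere; as a full product over u it is
  -- covered by the same Hölder integrability argument for every v.
  let c : Finset ι → ι → Ω → ℝ := fun v j => if j ∈ v then b j else β
  have hc : ∀ v j, MemLp (c v j) p.conjExponent μ := fun v j => by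
    by_cases hj : j ∈ v <;> simp only [c, hj, if_true, if_false, hb, hβ]
  have hprod : ∀ {v : Finset ι} (hv : v ⊆ u) (t : u → Ω), ∏ j : u, c v j (t j) =
      (∏ j : v, b j (t ⟨j, hv j.2⟩)) *
        ∏ j : ↥(u \ v), β (t ⟨j, (Finset.mem_sdiff.1 j.2).1⟩) := fun {v} hv t => by
    rw [prod_subtype_sdiff hv]
    congr 1
    · exact Finset.prod_congr rfl fun j _ => by simp [c]
    · exact Finset.prod_congr rfl fun j _ => by simp [c, (Finset.mem_sdiff.1 j.2).2]
  have hint : ∀ v, Integrable (fun t : u → Ω => g t * ∏ j : u, c v j (t j))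
      (Measure.pi fun _ => μ) := fun v => integrable_mul_prod hp hg fun j => hc v j
  have hsplit : ∀ t : u → Ω, g t * ∏ j : u, (b j (t j) + β (t j)) =
      ∑ v ∈ u.powerset, g t * ∏ j : u, c v j (t j) := fun t => by
    rw [prod_add_glue u b (fun _ => β) t, ← Finset.mul_sum,
      ← Finset.sum_attach _ fun v => ∏ j : u, c v j (t j)]
    congr 1
    exact Finset.sum_congr rfl fun v _ => (hprod (Finset.mem_powerset.1 v.2) t).symm
  simp only [hsplit]
  rw [integral_finsetSum _ fun v _ => hint v]
  refine Finset.sum_congr rfl fun v hv => ?_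
  have hv := Finset.mem_powerset.1 hv
  have hmp := measurePreserving_glue (μ := μ) hv
  rw [← hmp.map_eq, integral_map hmp.measurable.aemeasurable
    (by rw [hmp.map_eq]; exact (hint v).1)]
  refine (integral_prod _ (hmp.integrable_comp_of_integrable (hint v))).trans ?_
  simp only [Function.comp_def]
  refine integral_congr_ae (Eventually.of_forall fun t => ?_)
  simp only [partialIntegral]
  rw [← integral_mul_const]
  refine integral_congr_ae (Eventually.of_forall fun s => ?_)
  simp only [prod_glue hv (c v)]
  have h1 : ∏ j : v, c v j (t j) = ∏ j : v, b j (t j) :=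
    Finset.prod_congr rfl fun j _ => by simp [c]
  have h2 : ∏ j : ↥(u \ v), c v j (s j) = ∏ j : ↥(u \ v), β (s j) :=
    Finset.prod_congr rfl fun j _ => by simp [c, (Finset.mem_sdiff.1 j.2).2]
  rw [h1, h2]
  ring

end PartialIntegration

/-! ### The weighted measure ψ dt and the kernel divided by ψ. -/

lemma lintegral_fin_prod {Ω : Type*} [MeasurableSpace Ω] {μ : Measure Ω} [SigmaFinite μ] {n : ℕ}
    {f : Fin n → Ω → ℝ≥0∞} (hf : ∀ i, Measurable (f i)) :
    ∫⁻ x, ∏ i, f i (x i) ∂Measure.pi (fun _ => μ) = ∏ i, ∫⁻ x, f i x ∂μ := by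
  induction n with
  | zero => simp
  | succ n ih =>
    rw [← ((measurePreserving_piFinSuccAbove (fun _ : Fin (n + 1) => μ) 0).symm).lintegral_comp_emb
      (MeasurableEquiv.measurableEmbedding _)]
    simp_rw [MeasurableEquiv.piFinSuccAbove_symm_apply, Fin.insertNthEquiv,
      Fin.prod_univ_succ, Fin.insertNth_zero]
    simp only [Equiv.coe_fn_mk, Fin.cons_zero, Fin.cons_succ]
    rw [← ih fun i => hf (Fin.succ i)]
    exact lintegral_prod_mul (hf 0).aemeasurable (Finset.measurable_fun_prod _ fun i _ =>
      (hf (Fin.succ i)).comp (measurable_pi_apply i)).aemeasurable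

lemma lintegral_fintype_prod {δ : Type*} [Fintype δ] {Ω : Type*} [MeasurableSpace Ω]
    {μ : Measure Ω} [SigmaFinite μ] {f : δ → Ω → ℝ≥0∞} (hf : ∀ i, Measurable (f i)) :
    ∫⁻ x, ∏ i, f i (x i) ∂Measure.pi (fun _ => μ) = ∏ i, ∫⁻ x, f i x ∂μ := by
  let e := (Fintype.equivFin δ).symm
  rw [← (measurePreserving_piCongrLeft (fun _ : δ => μ) e).lintegral_comp_emb
    (MeasurableEquiv.measurableEmbedding _)]
  simp_rw [← e.prod_comp, MeasurableEquiv.coe_piCongrLeft, Equiv.piCongrLeft_apply_apply]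
  exact lintegral_fin_prod fun i => hf _

variable {D : Set ℝ} {ι : Type} {ψ : D → ℝ}

/-- The measure `ψ(t) dt` on `D`. -/
def weightedVolume (ψ : D → ℝ) : Measure D :=
  volume.withDensity fun t => ENNReal.ofReal (ψ t)

lemma sigmaFinite_volume (hD : D.OrdConnected) : SigmaFinite (volume : Measure D) := by
  refine SigmaFinite.of_map _ (f := Subtype.val) measurable_subtype_coe.aemeasurable ?_
  have := map_comap_subtype_coe hD.measurableSet (volume : Measure ℝ)
  rw [show (volume : Measure D) = Measure.comap Subtype.val volume from rfl, this]
  infer_instance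

lemma sigmaFinite_weightedVolume [SigmaFinite (volume : Measure D)] (ψ : D → ℝ) :
    SigmaFinite (weightedVolume ψ) :=
  SigmaFinite.withDensity_of_ne_top
    (Eventually.of_forall fun _ => ENNReal.ofReal_ne_top)

lemma weightedVolume_absolutelyContinuous : weightedVolume ψ ≪ volume :=
  withDensity_absolutelyContinuous _ _

lemma ae_weightedVolume_iff (hψ : Measurable ψ) (hψ_pos : ∀ᵐ t, 0 < ψ t) {P : D → Prop} :
    (∀ᵐ t ∂weightedVolume ψ, P t) ↔ ∀ᵐ t, P t := by
  refine ⟨fun h => ?_, fun h => weightedVolume_absolutelyContinuous h⟩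
  refine (withDensity_absolutelyContinuous' hψ.ennreal_ofReal.aemeasurable ?_) h
  filter_upwards [hψ_pos] with t ht
  simpa using ht

lemma ae_forall_pos [SigmaFinite (volume : Measure D)] (hψ_pos : ∀ᵐ t, 0 < ψ t) (u : Finset ι) :
    ∀ᵐ t : u → D, ∀ j, 0 < ψ (t j) :=
  ae_all_iff.2 fun j => (Measure.quasiMeasurePreserving_eval (fun _ : u => (volume : Measure D))
    j).ae hψ_pos

/-- Positivity of ψ lets `ENNReal.ofReal` pass through the product of the densities; equality on
boxes then identifies the measures. -/
lemma weightMeasure_eq_pi [SigmaFinite (volume : Measure D)] (hψ : Measurable ψ)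
    (hψ_pos : ∀ᵐ t, 0 < ψ t) (u : Finset ι) :
    weightMeasure ψ u = Measure.pi fun _ => weightedVolume ψ := by
  have := sigmaFinite_weightedVolume ψ
  refine (Measure.pi_eq fun s hs => ?_).symm
  rw [weightMeasure, withDensity_apply _ (MeasurableSet.univ_pi hs),
    ← lintegral_indicator (MeasurableSet.univ_pi hs)]
  have h1 : ∀ᵐ t : u → D, (Set.univ.pi s).indicator
      (fun t => ENNReal.ofReal (∏ j, ψ (t j))) t =
      ∏ j, (s j).indicator (fun x => ENNReal.ofReal (ψ x)) (t j) := by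
    filter_upwards [ae_forall_pos hψ_pos u] with t ht
    by_cases hts : t ∈ Set.univ.pi s
    · rw [Set.indicator_of_mem hts, ENNReal.ofReal_prod_of_nonneg fun j _ => (ht j).le]
      exact Finset.prod_congr rfl fun j _ => by rw [Set.indicator_of_mem (hts j trivial)]
    · rw [Set.indicator_of_notMem hts]
      simp only [Set.mem_pi, Set.mem_univ, forall_const, not_forall] at hts
      obtain ⟨j, hj⟩ := hts
      exact (Finset.prod_eq_zero (Finset.mem_univ j) (by simp [hj])).symm
  rw [lintegral_congr_ae h1, volume_pi,
    lintegral_fintype_prod fun j => hψ.ennreal_ofReal.indicator (hs j)]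
  refine Finset.prod_congr rfl fun j _ => ?_
  rw [lintegral_indicator (hs j), weightedVolume, withDensity_apply _ (hs j)]

/-- With the weight moved into the measure, the operator becomes a pairing of L^p with L^{p*} over
one product measure. -/
lemma K_eq_integral_weightMeasure [SigmaFinite (volume : Measure D)] (hψ : Measurable ψ)
    (hψ_pos : ∀ᵐ t, 0 < ψ t) (k : D → D → ℝ) (u : Finset ι) (g : (u → D) → ℝ) (x : u → D) :
    K k u g x = ∫ t, g t * ∏ j, (k (x j) (t j) / ψ (t j))
      ∂Measure.pi fun _ => weightedVolume ψ := by
  rw [← weightMeasure_eq_pi hψ hψ_pos, weightMeasure, integral_withDensity_eq_integral_toReal_smul₀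
    (Measurable.aemeasurable (by fun_prop)) (by simp)]
  refine integral_congr_ae ?_
  filter_upwards [ae_forall_pos hψ_pos u] with t ht
  have : 0 < ∏ j, ψ (t j) := Finset.prod_pos fun j _ => ht j
  rw [Finset.prod_div_distrib, ENNReal.toReal_ofReal this.le, smul_eq_mul]
  field_simp

/-- With q = p* finite, q/p = q - 1 gives |k/ψ|^q ψ = (|k|/ψ^{1/p})^q, so both norms agree; q = ∞
means p = 1, where the two functions have the same modulus. -/
lemma memLp_div_of_kappaHat (hψ : Measurable ψ) (hψ_pos : ∀ᵐ t, 0 < ψ t) {k : D → D → ℝ}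
    {p : ℝ≥0∞} (hp : 1 ≤ p) {x : D} (hk : Measurable (k x)) (h : kappaHat ψ k p x < ∞) :
    MemLp (fun t => k x t / ψ t) p.conjExponent (weightedVolume ψ) := by
  have hm : Measurable fun t => k x t / ψ t := hk.div hψ
  refine ⟨hm.aestronglyMeasurable, lt_of_le_of_lt ?_ h⟩
  unfold kappaHat
  have hconj := ENNReal.HolderConjugate.conjExponent hp
  by_cases hq : p.conjExponent = ∞
  · have hp1 : p = 1 := by
      have := hconj.inv_add_inv_eq_inv
      simpa [hq] using this
    rw [hq]
    refine (eLpNorm_exponent_top (f := fun t => k x t / ψ t)).trans_le ?_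
    refine (eLpNormEssSup_mono_measure _ weightedVolume_absolutelyContinuous).trans ?_
    rw [← eLpNorm_exponent_top]
    refine eLpNorm_mono_enorm_ae ?_
    filter_upwards [hψ_pos] with t ht
    simp [hp1, enorm_eq_nnnorm, nnnorm_div]
  · have hq0 : p.conjExponent ≠ 0 := by simp [ENNReal.conjExponent]
    rw [eLpNorm_eq_lintegral_rpow_enorm_toReal hq0 hq, eLpNorm_eq_lintegral_rpow_enorm_toReal hq0 hq]
    set q := p.conjExponent.toReal with hqdef
    have hqpos : 0 < q := ENNReal.toReal_pos hq0 hq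
    have hpq : (p⁻¹).toReal * q = q - 1 := by
      have := hconj.inv_add_inv_eq_inv
      have h2 := congrArg ENNReal.toReal this
      rw [ENNReal.toReal_add (by simpa using (zero_lt_one.trans_le hp).ne') (by simpa using hq0),
        ENNReal.toReal_inv p.conjExponent, ← hqdef] at h2
      simp only [inv_one, ENNReal.toReal_one] at h2
      field_simp at h2 ⊢
      linarith
    rw [weightedVolume, lintegral_withDensity_eq_lintegral_mul _ hψ.ennreal_ofReal
      (hm.enorm.pow_const q)]
    refine ENNReal.rpow_le_rpow (lintegral_mono_ae ?_) (by positivity)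
    filter_upwards [hψ_pos] with t ht
    refine le_of_eq ?_
    have h3 : 0 < ψ t ^ (p⁻¹).toReal := Real.rpow_pos_of_pos ht _
    simp only [Pi.mul_apply, Real.enorm_eq_ofReal_abs, abs_div, abs_abs, abs_of_pos ht, abs_of_pos h3]
    rw [ENNReal.ofReal_rpow_of_nonneg (by positivity) hqpos.le,
      ENNReal.ofReal_rpow_of_nonneg (by positivity) hqpos.le, ← ENNReal.ofReal_mul ht.le,
      Real.div_rpow (abs_nonneg _) ht.le, Real.div_rpow (abs_nonneg _) h3.le, ← Real.rpow_mul ht.le,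
      hpq, Real.rpow_sub_one ht.ne']
    congr 1
    have : 0 < ψ t ^ q := Real.rpow_pos_of_pos ht _
    field_simp

/-! ### Change of kernel on components, and uniqueness of components. -/

section Representation

variable {D : Set ℝ} [SigmaFinite (volume : Measure D)] {ι : Type} {ψ : D → ℝ}

lemma memLp_weightMeasure_iff (hψ : Measurable ψ) (hψ_pos : ∀ᵐ t, 0 < ψ t) {u : Finset ι}
    {p : ℝ≥0∞} {g : (u → D) → ℝ} :
    MemLp g p (weightMeasure ψ u) ↔ MemLp g p (Measure.pi fun _ => weightedVolume ψ) := by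
  rw [weightMeasure_eq_pi hψ hψ_pos]

lemma K_eq_zero_of_ae (hψ : Measurable ψ) (hψ_pos : ∀ᵐ t, 0 < ψ t) (k : D → D → ℝ) {u : Finset ι}
    {g : (u → D) → ℝ} (hg : g =ᵐ[weightMeasure ψ u] 0) (x : u → D) : K k u g x = 0 := by
  rw [K_eq_integral_weightMeasure hψ hψ_pos, ← weightMeasure_eq_pi hψ hψ_pos]
  refine (integral_congr_ae (g := fun _ => 0) ?_).trans (integral_zero _ _)
  filter_upwards [hg] with t ht
  simp [ht]

lemma K_sum (hψ : Measurable ψ) (hψ_pos : ∀ᵐ t, 0 < ψ t) {k : D → D → ℝ} {p : ℝ≥0∞} (hp : 1 ≤ p)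
    (hk : ∀ x, MemLp (fun t => k x t / ψ t) p.conjExponent (weightedVolume ψ)) {u : Finset ι}
    {δ : Type*} (A : Finset δ) {g : δ → (u → D) → ℝ}
    (hg : ∀ i ∈ A, MemLp (g i) p (weightMeasure ψ u)) (x : u → D) :
    K k u (fun t => ∑ i ∈ A, g i t) x = ∑ i ∈ A, K k u (g i) x := by
  have := sigmaFinite_weightedVolume ψ
  simp only [K_eq_integral_weightMeasure hψ hψ_pos, Finset.sum_mul]
  exact integral_finsetSum _ fun i hi => integrable_mul_prod hp
    ((memLp_weightMeasure_iff hψ hψ_pos).1 (hg i hi)) fun j => hk (x j)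

lemma K_sub (hψ : Measurable ψ) (hψ_pos : ∀ᵐ t, 0 < ψ t) {k : D → D → ℝ} {p : ℝ≥0∞} (hp : 1 ≤ p)
    (hk : ∀ x, MemLp (fun t => k x t / ψ t) p.conjExponent (weightedVolume ψ)) {u : Finset ι}
    {g h : (u → D) → ℝ} (hg : MemLp g p (weightMeasure ψ u)) (hh : MemLp h p (weightMeasure ψ u))
    (x : u → D) : K k u (g - h) x = K k u g x - K k u h x := by
  have := sigmaFinite_weightedVolume ψ
  simp only [K_eq_integral_weightMeasure hψ hψ_pos, Pi.sub_apply, sub_mul]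
  exact integral_sub
    (integrable_mul_prod hp ((memLp_weightMeasure_iff hψ hψ_pos).1 hg) fun j => hk (x j))
    (integrable_mul_prod hp ((memLp_weightMeasure_iff hψ hψ_pos).1 hh) fun j => hk (x j))

omit [SigmaFinite (volume : Measure D)] in
lemma K_zero (k : D → D → ℝ) (u : Finset ι) (x : u → D) : K k u 0 x = 0 := by
  simp [K]

lemma Represents.sub (hψ : Measurable ψ) (hψ_pos : ∀ᵐ t, 0 < ψ t) {k : D → D → ℝ} {p : ℝ≥0∞}
    (hp : 1 ≤ p) (hk : ∀ x, MemLp (fun t => k x t / ψ t) p.conjExponent (weightedVolume ψ))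
    {f f' : (ι → D) → ℝ} {g g' : ∀ u : Finset ι, (u → D) → ℝ} (h : Represents k ψ p f g)
    (h' : Represents k ψ p f' g') : Represents k ψ p (f - f') (g - g') := by
  classical
  obtain ⟨hg, A, hA, hf⟩ := h
  obtain ⟨hg', A', hA', hf'⟩ := h'
  refine ⟨fun u => (hg u).sub (hg' u), A ∪ A', fun u hu => ?_, fun x => ?_⟩
  · rw [Finset.notMem_union] at hu
    rw [Pi.sub_apply, hA u hu.1, hA' u hu.2, sub_zero]
  · simp only [Pi.sub_apply, K_sub hψ hψ_pos hp hk (hg _) (hg' _), Finset.sum_sub_distrib, hf, hf']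
    congr 1
    · exact Finset.sum_subset Finset.subset_union_left fun u _ hu => by rw [hA u hu, K_zero]
    · exact Finset.sum_subset Finset.subset_union_right fun u _ hu => by rw [hA' u hu, K_zero]

variable [DecidableEq ι]

/-- The components of `∑ u ∈ A, K_u(g_u)` after `b` has been subtracted from the kernel. -/
def transform (ψ b : D → ℝ) (A : Finset (Finset ι)) (g : ∀ u : Finset ι, (u → D) → ℝ)
    (v : Finset ι) (t : v → D) : ℝ :=
  ∑ u ∈ A with v ⊆ u, partialIntegral (weightedVolume ψ) (fun x => b x / ψ x) v u (g u) t

lemma represents_transform (hψ : Measurable ψ) (hψ_pos : ∀ᵐ t, 0 < ψ t) {k k' : D → D → ℝ}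
    {b : D → ℝ} (hkk' : ∀ x t, k x t = k' x t + b t)
    (hb : Integrable (fun t => b t / ψ t) (weightedVolume ψ))
    (hb' : MemLp (fun t => b t / ψ t) ∞ (weightedVolume ψ)) {p : ℝ≥0∞} (hp : 1 ≤ p)
    (hk' : ∀ x, MemLp (fun t => k' x t / ψ t) p.conjExponent (weightedVolume ψ))
    {f : (ι → D) → ℝ} {g : ∀ u : Finset ι, (u → D) → ℝ} {A : Finset (Finset ι)}
    (hg : ∀ u, MemLp (g u) p (weightMeasure ψ u))
    (hf : ∀ x, f x = ∑ u ∈ A, K k u (g u) fun j => x j) :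
    Represents k' ψ p f (transform ψ b A g) := by
  have := sigmaFinite_weightedVolume ψ
  have hP : ∀ {v u : Finset ι}, v ⊆ u → MemLp (partialIntegral (weightedVolume ψ)
      (fun x => b x / ψ x) v u (g u)) p (weightMeasure ψ v) := fun {v u} h =>
    (memLp_weightMeasure_iff hψ hψ_pos).2
      (memLp_partialIntegral h hb hb' hp ((memLp_weightMeasure_iff hψ hψ_pos).1 (hg u)))
  refine ⟨fun v => ?_, A.biUnion Finset.powerset, fun v hv => ?_, fun x => ?_⟩
  · exact memLp_finsetSum _ fun u hu => hP (Finset.mem_filter.1 hu).2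
  · ext t
    simp only [Finset.mem_biUnion, Finset.mem_powerset, not_exists, not_and] at hv
    rw [transform, Finset.filter_false_of_mem hv]
    rfl
  · have hexp : ∀ u ∈ A, K k u (g u) (fun j => x j) = ∑ v ∈ u.powerset,
        K k' v (partialIntegral (weightedVolume ψ) (fun x => b x / ψ x) v u (g u)) fun j => x j :=
      fun u _ => by
        simp only [K_eq_integral_weightMeasure hψ hψ_pos, hkk', add_div]
        exact integral_mul_prod_add hp ((memLp_weightMeasure_iff hψ hψ_pos).1 (hg u))
          (b := fun j t => k' (x j) t / ψ t) (fun j => hk' (x j))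
          (memLp_of_integrable_of_memLp_top hb hb' (by simp [ENNReal.conjExponent]))
    rw [hf, Finset.sum_congr rfl hexp, Finset.sum_comm' (t' := A.biUnion Finset.powerset)
      (s' := fun v => A.filter (v ⊆ ·))]
    · refine Finset.sum_congr rfl fun v _ => ?_
      exact (K_sum hψ hψ_pos hp hk' _ (fun u hu => hP (Finset.mem_filter.1 hu).2) _).symm
    · intro u v
      simp only [Finset.mem_powerset, Finset.mem_filter, Finset.mem_biUnion]
      exact ⟨fun h => ⟨h, u, h⟩, fun h => h.1⟩

/-- Placing the coordinates outside u at the anchor kills every term whose index is not contained in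
u. The smaller indices vanish by induction, which leaves K_u(g_u) = 0. -/
lemma Represents.ae_eq_zero_of_anchored (hψ : Measurable ψ) (hψ_pos : ∀ᵐ t, 0 < ψ t)
    {κ : D → D → ℝ} {a : D} (ha : ∀ t, κ a t = 0) {p : ℝ≥0∞} (hκ : Admissible ι ψ κ p)
    {g : ∀ u : Finset ι, (u → D) → ℝ} (h : Represents κ ψ p 0 g) (u : Finset ι) :
    g u =ᵐ[weightMeasure ψ u] 0 := by
  obtain ⟨hg, A, hA, hf⟩ := h
  induction u using Finset.strongInduction with
  | H u ih =>
  by_cases huA : u ∈ A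
  swap
  · rw [hA u huA]
  have hK : ∀ x, K κ u (g u) x = 0 := fun x => by
    let y : ι → D := fun j => if hj : j ∈ u then x ⟨j, hj⟩ else a
    have hy : (fun j : u => y j) = x := by ext j; simp [y]
    have h1 := hf y
    rw [Pi.zero_apply, Finset.sum_eq_single_of_mem u huA, hy] at h1
    · exact h1.symm
    intro w _ hw
    by_cases hwu : w ⊆ u
    · exact K_eq_zero_of_ae hψ hψ_pos κ (ih w (hwu.ssubset_of_ne hw)) _
    · obtain ⟨j, hj, hju⟩ := Finset.not_subset.1 hwu
      have : ∀ t : w → D, ∏ i : w, κ (y i) (t i) = 0 := fun t =>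
        Finset.prod_eq_zero (Finset.mem_univ ⟨j, hj⟩) (by simp [y, hju, ha])
      simp only [K, this, mul_zero, integral_zero]
  -- Injectivity is assumed only for nonempty u; for u = ∅ the operator is evaluation of a constant.
  rcases u.eq_empty_or_nonempty with rfl | hu
  · refine Eventually.of_forall fun t => ?_
    have h1 := hK t
    simp only [K, Finset.univ_eq_empty, Finset.prod_empty, mul_one, integral_unique] at h1
    rw [volume_pi, measureReal_def, Measure.pi_univ] at h1
    rw [Subsingleton.elim t default]
    simpa using h1
  · exact withDensity_absolutelyContinuous _ _ (hκ.injective u (g u) hu (hg u) hK)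

/-- Only u = v survives in the sum, and there no coordinate is integrated out. This serves the
choice of a maximal nonzero component. -/
lemma transform_top {b : D → ℝ} (hψ : Measurable ψ) (hψ_pos : ∀ᵐ t, 0 < ψ t)
    (hb : Integrable (fun t => b t / ψ t) (weightedVolume ψ)) {A : Finset (Finset ι)}
    {g : ∀ u : Finset ι, (u → D) → ℝ} {v : Finset ι} (hv : v ∈ A)
    (hg : ∀ u ∈ A, v ⊂ u → g u =ᵐ[weightMeasure ψ u] 0) :
    transform ψ b A g v =ᵐ[weightMeasure ψ v] g v := by
  have := sigmaFinite_weightedVolume ψ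
  have h1 : ∀ u ∈ (A.filter (v ⊆ ·)).erase v, partialIntegral (weightedVolume ψ)
      (fun x => b x / ψ x) v u (g u) =ᵐ[weightMeasure ψ v] 0 := fun u hu => by
    obtain ⟨huv, hu⟩ := Finset.mem_erase.1 hu
    obtain ⟨huA, hu⟩ := Finset.mem_filter.1 hu
    have := hg u huA (hu.ssubset_of_ne huv.symm)
    rw [weightMeasure_eq_pi hψ hψ_pos] at this ⊢
    exact partialIntegral_ae_eq_zero hu hb this
  filter_upwards [(Finset.eventually_all _).2 h1] with t ht
  rw [transform, ← Finset.add_sum_erase _ _ (Finset.mem_filter.2 ⟨hv, Finset.Subset.refl v⟩),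
    Finset.sum_eq_zero fun u hu => ht u hu, add_zero, partialIntegral_self]

/-- Transforming with -b returns to the anchored kernel, where all components vanish. A nonzero
component of maximal cardinality would pass through that transform unchanged, a contradiction. -/
lemma Represents.ae_eq_zero (hψ : Measurable ψ) (hψ_pos : ∀ᵐ t, 0 < ψ t)
    {κ k' : D → D → ℝ} {a : D} (ha : ∀ t, κ a t = 0) {p : ℝ≥0∞} (hp : 1 ≤ p)
    (hκ : Admissible ι ψ κ p)
    (hk : ∀ x, MemLp (fun t => κ x t / ψ t) p.conjExponent (weightedVolume ψ))
    {b : D → ℝ} (hkk' : ∀ x t, κ x t = k' x t + b t)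
    (hb : Integrable (fun t => b t / ψ t) (weightedVolume ψ))
    (hb' : MemLp (fun t => b t / ψ t) ∞ (weightedVolume ψ))
    {g : ∀ u : Finset ι, (u → D) → ℝ} (h : Represents k' ψ p 0 g) (u : Finset ι) :
    g u =ᵐ[weightMeasure ψ u] 0 := by
  classical
  obtain ⟨hg, A, hA, hf⟩ := h
  have hnb : Integrable (fun t => -b t / ψ t) (weightedVolume ψ) := by
    simpa only [neg_div, Pi.neg_def] using hb.neg
  have hnb' : MemLp (fun t => -b t / ψ t) ∞ (weightedVolume ψ) := by
    simpa only [neg_div, Pi.neg_def] using hb'.neg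
  have hT := (represents_transform hψ hψ_pos (fun x t => show k' x t = κ x t + -b t by
    rw [hkk']; ring) hnb hnb' hp hk hg hf).ae_eq_zero_of_anchored hψ hψ_pos ha hκ
  by_contra hu
  have hne : (A.filter fun u => ¬ g u =ᵐ[weightMeasure ψ u] 0).Nonempty := by
    refine ⟨u, Finset.mem_filter.2 ⟨?_, hu⟩⟩
    by_contra huA
    exact hu (by rw [hA u huA])
  obtain ⟨v, hv, hmax⟩ := Finset.exists_max_image _ Finset.card hne
  obtain ⟨hvA, hv⟩ := Finset.mem_filter.1 hv
  refine hv ((transform_top hψ hψ_pos hnb hvA fun w hw hvw => ?_).symm.trans (hT v))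
  by_contra hwne
  exact absurd (hmax w (Finset.mem_filter.2 ⟨hw, hwne⟩)) (not_le.2 (Finset.card_lt_card hvw))

end Representation

/-! ### Embedding norms from bounds on components. -/

section Norms

variable {D : Set ℝ} {ι : Type} {ψ : D → ℝ}

lemma coeffNorm_congr {γ : Finset ι → ℝ≥0} {p₁ p₂ : ℝ≥0∞} {g h : ∀ u : Finset ι, (u → D) → ℝ}
    (hgh : ∀ u, g u =ᵐ[weightMeasure ψ u] h u) :
    coeffNorm ψ γ p₁ p₂ g = coeffNorm ψ γ p₁ p₂ h := by
  simp only [coeffNorm, fun u => eLpNorm_congr_ae (p := p₁) (hgh u)]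

lemma coeffNorm_zero {γ : Finset ι → ℝ≥0} {p₁ p₂ : ℝ≥0∞} (hp₂ : 1 ≤ p₂) :
    coeffNorm ψ γ p₁ p₂ (0 : ∀ u : Finset ι, (u → D) → ℝ) = 0 := by
  by_cases h : p₂ = ∞
  · simp [coeffNorm, h]
  · have : 0 < p₂.toReal := ENNReal.toReal_pos (zero_lt_one.trans_le hp₂).ne' h
    simp [coeffNorm, h, this]

lemma spaceNorm_zero {k : D → D → ℝ} {γ : Finset ι → ℝ≥0} {p₁ p₂ : ℝ≥0∞} (hp₂ : 1 ≤ p₂) :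
    spaceNorm k ψ γ p₁ p₂ 0 = 0 := by
  refine le_antisymm ((iInf₂_le (0 : ∀ u : Finset ι, (u → D) → ℝ) ⟨fun _ => MemLp.zero, ∅,
    fun _ _ => rfl, fun x => by simp⟩).trans_eq (coeffNorm_zero hp₂)) bot_le

/-- Constant sequences are Cauchy, so every admissible constant is tested on the single function f.
-/
lemma le_embeddingNorm {X : Type} {M N : (X → ℝ) → ℝ≥0∞} (hM : M 0 = 0) {f : X → ℝ}
    (hf : M f < ∞) {c : ℝ≥0∞} (h : ∀ C, N f ≤ C * M f → c ≤ C) : c ≤ embeddingNorm M N := by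
  refine le_sInf fun C hC => h C ?_
  have := (hC (fun _ => f) ⟨fun _ => hf, fun ε hε => ⟨0, fun m _ n _ => by simp [hM]⟩⟩).2
  simpa using this

lemma embeddingNorm_le {X : Type} {M N : (X → ℝ) → ℝ≥0∞} {C : ℝ≥0∞}
    (h : C ≠ ∞ → ∀ f, M f < ∞ → N f ≤ C * M f) : embeddingNorm M N ≤ C := by
  by_cases hC : C = ∞
  · simp [hC]
  replace h := h hC
  refine sInf_le fun f hf => ⟨⟨fun n => (h _ (hf.1 n)).trans_lt
    (ENNReal.mul_lt_top (lt_top_iff_ne_top.2 hC) (hf.1 n)), fun ε hε => ?_⟩, ?_⟩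
  · obtain ⟨δ, hδ, hδε⟩ : ∃ δ : ℝ≥0∞, 0 < δ ∧ δ < ∞ ∧ C * δ ≤ ε := by
      -- The minimum with 1 keeps δ finite when ε = ∞; C + 1 avoids division by zero.
      refine ⟨min 1 (ε / (C + 1)), lt_min zero_lt_one (ENNReal.div_pos hε.ne' (by simp [hC])),
        (min_le_left _ _).trans_lt ENNReal.one_lt_top, ?_⟩
      calc C * min 1 (ε / (C + 1)) ≤ (C + 1) * (ε / (C + 1)) := by
            gcongr
            · exact le_self_add
            · exact min_le_right _ _
        _ ≤ ε := ENNReal.mul_div_le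
    obtain ⟨n₀, hn₀⟩ := hf.2 δ hδ
    refine ⟨n₀, fun m hm n hn => ?_⟩
    have h1 := hn₀ m hm n hn
    exact (h _ (h1.trans_lt hδε.1)).trans ((mul_le_mul_right h1 C).trans hδε.2)
  · rw [← ENNReal.limsup_const_mul_of_ne_top hC]
    exact limsup_le_limsup (Eventually.of_forall fun n => h _ (hf.1 n))

lemma spaceNorm_le_mul {k k' : D → D → ℝ} {γ : Finset ι → ℝ≥0} {p₁ p₂ C : ℝ≥0∞} (hC : C ≠ ∞)
    (h : ∀ f g, Represents k ψ p₁ f g → coeffNorm ψ γ p₁ p₂ g < ∞ →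
      spaceNorm k' ψ γ p₁ p₂ f ≤ C * coeffNorm ψ γ p₁ p₂ g)
    {f : (ι → D) → ℝ} (hf : spaceNorm k ψ γ p₁ p₂ f < ∞) :
    spaceNorm k' ψ γ p₁ p₂ f ≤ C * spaceNorm k ψ γ p₁ p₂ f := by
  refine ENNReal.le_mul_of_forall_lt (Or.inr hf.ne) (Or.inl hC) fun C' hC' y hy => ?_
  obtain ⟨g, hg⟩ := iInf_lt_iff.1 hy
  obtain ⟨hg, hgy⟩ := iInf_lt_iff.1 hg
  exact (h f g hg (hgy.trans_le le_top)).trans (mul_le_mul' hC'.le hgy.le)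

end Norms

/-! ### Hölder interpolation for nonnegative matrices on ℓ^p. -/

section Schur

variable {I : Type*}

lemma tsum_rpow_mul_rpow_mul_rpow_le (f g h : I → ℝ≥0∞) {a b c : ℝ} (ha : 0 ≤ a) (hb : 0 ≤ b)
    (hc : 0 ≤ c) (habc : a + b + c = 1) :
    ∑' i, f i ^ a * g i ^ b * h i ^ c ≤ (∑' i, f i) ^ a * (∑' i, g i) ^ b * (∑' i, h i) ^ c := by
  let : MeasurableSpace I := ⊤
  have := ENNReal.lintegral_prod_norm_pow_le (μ := Measure.count) (Finset.univ : Finset (Fin 3))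
    (f := ![f, g, h]) (fun i _ => measurable_from_top.aemeasurable) (p := ![a, b, c])
    (by simpa [Fin.sum_univ_three] using habc)
    (fun i _ => by fin_cases i <;> simpa)
  simpa [Fin.prod_univ_three, lintegral_count] using this

/-- The `ℓ^p` norm of a family in `[0,∞]`. -/
def seqNorm (p : ℝ≥0∞) (x : I → ℝ≥0∞) : ℝ≥0∞ :=
  if p = ∞ then ⨆ i, x i else (∑' i, x i ^ p.toReal) ^ (1 / p.toReal)

lemma seqNorm_mono {p : ℝ≥0∞} {x y : I → ℝ≥0∞} (h : ∀ i, x i ≤ y i) : seqNorm p x ≤ seqNorm p y := by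
  unfold seqNorm
  split_ifs
  · exact iSup_mono h
  · exact ENNReal.rpow_le_rpow (ENNReal.tsum_le_tsum fun i =>
      ENNReal.rpow_le_rpow (h i) ENNReal.toReal_nonneg) (by positivity)

lemma le_seqNorm {p : ℝ≥0∞} (hp : 1 ≤ p) (x : I → ℝ≥0∞) (i : I) : x i ≤ seqNorm p x := by
  unfold seqNorm
  split_ifs with h
  · exact le_iSup x i
  · have hq : 0 < p.toReal := ENNReal.toReal_pos (zero_lt_one.trans_le hp).ne' h
    calc x i = (x i ^ p.toReal) ^ (1 / p.toReal) := by
          rw [← ENNReal.rpow_mul, mul_one_div_cancel hq.ne', ENNReal.rpow_one]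
      _ ≤ _ := by
          gcongr
          exact ENNReal.le_tsum i

/-- The largest sum over a row. -/
def rowSum (b : I → I → ℝ≥0∞) : ℝ≥0∞ := ⨆ v, ∑' u, b v u

/-- The largest sum over a column. -/
def colSum (b : I → I → ℝ≥0∞) : ℝ≥0∞ := ⨆ u, ∑' v, b v u

lemma tsum_tsum_mul_le_colSum (b : I → I → ℝ≥0∞) (x : I → ℝ≥0∞) :
    ∑' v, ∑' u, b v u * x u ≤ colSum b * ∑' u, x u := by
  rw [ENNReal.tsum_comm, ← ENNReal.tsum_mul_left]
  refine ENNReal.tsum_le_tsum fun u => ?_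
  rw [ENNReal.tsum_mul_right]
  exact mul_le_mul_left (le_iSup (fun u => ∑' v, b v u) u) _

lemma rpow_split (x : ℝ≥0∞) {a b c : ℝ} (ha : 0 ≤ a) (hb : 0 ≤ b) (h : c = a + b) :
    x ^ c = x ^ a * x ^ b := by
  rw [h, ENNReal.rpow_add_of_nonneg _ _ ha hb]

/-- Interpolation between `ℓ^∞ → ℓ^∞` for both matrices and `ℓ^1 → ℓ^1` for the first one. -/
lemma seqNorm_matrix_le_of_le (b c : I → I → ℝ≥0∞) {p : ℝ≥0∞} (hp : 1 ≤ p) {θ : ℝ} (hθ : θ ≤ 1)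
    (hpθ : (p⁻¹).toReal ≤ θ) (x : I → ℝ≥0∞) :
    seqNorm p (fun v => ∑' u, b v u ^ θ * c v u ^ (1 - θ) * x u) ≤
      rowSum b ^ (θ - (p⁻¹).toReal) * colSum b ^ (p⁻¹).toReal * rowSum c ^ (1 - θ) *
        seqNorm p x := by
  have hθ' : 0 ≤ 1 - θ := sub_nonneg.2 hθ
  unfold seqNorm
  split_ifs with h
  · subst h
    simp only [ENNReal.inv_top, ENNReal.toReal_zero, sub_zero, ENNReal.rpow_zero, mul_one] at hpθ ⊢
    refine iSup_le fun v => ?_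
    calc ∑' u, b v u ^ θ * c v u ^ (1 - θ) * x u
        -- A dummy third factor fits the three-term Hölder inequality; it is harmless for infinite
        -- index sets because ∞ ^ 0 = 1.
        ≤ (∑' u, b v u ^ θ * c v u ^ (1 - θ) * (1 : ℝ≥0∞) ^ (0 : ℝ)) * ⨆ u, x u := by
          rw [← ENNReal.tsum_mul_right]
          refine ENNReal.tsum_le_tsum fun u => ?_
          rw [ENNReal.rpow_zero, mul_one]
          exact mul_le_mul_right (le_iSup x u) _
      _ ≤ ((∑' u, b v u) ^ θ * (∑' u, c v u) ^ (1 - θ) * (∑' _ : I, 1) ^ (0 : ℝ)) * ⨆ u, x u := by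
          gcongr
          exact tsum_rpow_mul_rpow_mul_rpow_le _ _ (fun _ => 1) hpθ hθ' le_rfl (by ring)
      _ ≤ _ := by
          rw [ENNReal.rpow_zero, mul_one]
          gcongr
          · exact le_iSup (fun v => ∑' u, b v u) v
          · exact le_iSup (fun v => ∑' u, c v u) v
  · have hq : 0 < p.toReal := ENNReal.toReal_pos (zero_lt_one.trans_le hp).ne' h
    rw [ENNReal.toReal_inv] at hpθ ⊢
    set q := p.toReal
    have hφ : 0 ≤ q⁻¹ := by positivity
    have hθφ : 0 ≤ θ - q⁻¹ := sub_nonneg.2 hpθ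
    -- Hölder with exponents θ - 1/q, 1 - θ, 1/q, after moving b^{1/q} next to x; the sum over v
    -- then meets only column sums of b.
    have hrow : ∀ v, ∑' u, b v u ^ θ * c v u ^ (1 - θ) * x u ≤
        rowSum b ^ (θ - q⁻¹) * rowSum c ^ (1 - θ) * (∑' u, b v u * x u ^ q) ^ q⁻¹ := fun v => by
      calc ∑' u, b v u ^ θ * c v u ^ (1 - θ) * x u
          = ∑' u, b v u ^ (θ - q⁻¹) * c v u ^ (1 - θ) * (b v u * x u ^ q) ^ q⁻¹ := by
            refine tsum_congr fun u => ?_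
            rw [ENNReal.mul_rpow_of_nonneg _ _ hφ, ← ENNReal.rpow_mul, mul_inv_cancel₀ hq.ne',
              ENNReal.rpow_one, rpow_split (b v u) hθφ hφ (by ring)]
            ring
        _ ≤ _ := tsum_rpow_mul_rpow_mul_rpow_le _ _ _ hθφ hθ' hφ (by ring)
        _ ≤ _ := by
            gcongr
            · exact le_iSup (fun v => ∑' u, b v u) v
            · exact le_iSup (fun v => ∑' u, c v u) v
    simp only [one_div]
    calc (∑' v, (∑' u, b v u ^ θ * c v u ^ (1 - θ) * x u) ^ q) ^ q⁻¹
        ≤ (∑' v, (rowSum b ^ (θ - q⁻¹) * rowSum c ^ (1 - θ)) ^ q *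
            ∑' u, b v u * x u ^ q) ^ q⁻¹ := by
          gcongr with v
          refine (ENNReal.rpow_le_rpow (hrow v) hq.le).trans_eq ?_
          rw [ENNReal.mul_rpow_of_nonneg _ _ hq.le, ← ENNReal.rpow_mul _ q⁻¹,
            inv_mul_cancel₀ hq.ne', ENNReal.rpow_one]
      _ ≤ ((rowSum b ^ (θ - q⁻¹) * rowSum c ^ (1 - θ)) ^ q *
            (colSum b * ∑' u, x u ^ q)) ^ q⁻¹ := by
          rw [ENNReal.tsum_mul_left]
          gcongr
          exact tsum_tsum_mul_le_colSum b _
      _ = _ := by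
          rw [ENNReal.mul_rpow_of_nonneg _ _ hφ, ← ENNReal.rpow_mul _ q, mul_inv_cancel₀ hq.ne',
            ENNReal.rpow_one, ENNReal.mul_rpow_of_nonneg _ _ hφ]
          ring

/-- Interpolation between `ℓ^1 → ℓ^1` for both matrices and `ℓ^∞ → ℓ^∞` for the second one. -/
lemma seqNorm_matrix_le_of_lt (b c : I → I → ℝ≥0∞) {p : ℝ≥0∞} (hp : 1 ≤ p) {θ : ℝ} (hθ : 0 ≤ θ)
    (hpθ : θ < (p⁻¹).toReal) (x : I → ℝ≥0∞) :
    seqNorm p (fun v => ∑' u, b v u ^ θ * c v u ^ (1 - θ) * x u) ≤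
      colSum c ^ ((p⁻¹).toReal - θ) * colSum b ^ θ * rowSum c ^ (1 - (p⁻¹).toReal) *
        seqNorm p x := by
  have h : p ≠ ∞ := by
    rintro rfl
    simp at hpθ
    linarith
  have hφ1 := toReal_inv_le_one hp
  unfold seqNorm
  rw [if_neg h, if_neg h]
  have hq : 0 < p.toReal := ENNReal.toReal_pos (zero_lt_one.trans_le hp).ne' h
  rw [ENNReal.toReal_inv] at hpθ hφ1 ⊢
  set q := p.toReal
  have hφ : 0 ≤ q⁻¹ := by positivity
  have hθφ : 0 ≤ q⁻¹ - θ := sub_nonneg.2 hpθ.le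
  have hφ1' : 0 ≤ 1 - q⁻¹ := sub_nonneg.2 hφ1
  set S : I → ℝ≥0∞ := fun v => ∑' u, b v u * x u ^ q
  set T : I → ℝ≥0∞ := fun v => ∑' u, c v u * x u ^ q
  -- Hölder with exponents θ, 1/q - θ, 1 - 1/q: x^q is shared between b and c in the first two
  -- factors, and the rest of c gives a row sum.
  have hrow : ∀ v, ∑' u, b v u ^ θ * c v u ^ (1 - θ) * x u ≤
      S v ^ θ * T v ^ (q⁻¹ - θ) * rowSum c ^ (1 - q⁻¹) := fun v => by
    calc ∑' u, b v u ^ θ * c v u ^ (1 - θ) * x u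
        = ∑' u, (b v u * x u ^ q) ^ θ * (c v u * x u ^ q) ^ (q⁻¹ - θ) * c v u ^ (1 - q⁻¹) := by
          refine tsum_congr fun u => ?_
          have hx : x u = (x u ^ q) ^ θ * (x u ^ q) ^ (q⁻¹ - θ) := by
            rw [← rpow_split (x u ^ q) hθ hθφ rfl, ← ENNReal.rpow_mul, add_sub_cancel,
              mul_inv_cancel₀ hq.ne', ENNReal.rpow_one]
          rw [ENNReal.mul_rpow_of_nonneg _ _ hθ, ENNReal.mul_rpow_of_nonneg _ _ hθφ,
            rpow_split (c v u) hθφ hφ1' (by ring)]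
          nth_rewrite 1 [hx]
          ring
      _ ≤ _ := tsum_rpow_mul_rpow_mul_rpow_le _ _ _ hθ hθφ hφ1' (by ring)
      _ ≤ _ := by
          gcongr
          exact le_iSup (fun v => ∑' u, c v u) v
  simp only [one_div]
  -- Exponents for a second Hölder inequality, now in v, which separates the column sums of b and c.
  have hθq : θ * q + (q⁻¹ - θ) * q + 0 = 1 := by field_simp; ring
  calc (∑' v, (∑' u, b v u ^ θ * c v u ^ (1 - θ) * x u) ^ q) ^ q⁻¹
      ≤ (∑' v, S v ^ (θ * q) * T v ^ ((q⁻¹ - θ) * q) * (1 : ℝ≥0∞) ^ (0 : ℝ) *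
          (rowSum c ^ (1 - q⁻¹)) ^ q) ^ q⁻¹ := by
        gcongr with v
        refine (ENNReal.rpow_le_rpow (hrow v) hq.le).trans_eq ?_
        rw [ENNReal.mul_rpow_of_nonneg _ _ hq.le, ENNReal.mul_rpow_of_nonneg _ _ hq.le,
          ← ENNReal.rpow_mul, ← ENNReal.rpow_mul, ENNReal.rpow_zero, mul_one]
    _ ≤ (((colSum b * ∑' u, x u ^ q) ^ (θ * q) * (colSum c * ∑' u, x u ^ q) ^ ((q⁻¹ - θ) * q)) *
          (rowSum c ^ (1 - q⁻¹)) ^ q) ^ q⁻¹ := by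
        rw [ENNReal.tsum_mul_right]
        gcongr
        refine (tsum_rpow_mul_rpow_mul_rpow_le S T (fun _ => 1) (by positivity) (by positivity)
          le_rfl hθq).trans ?_
        rw [ENNReal.rpow_zero, mul_one]
        gcongr
        · exact tsum_tsum_mul_le_colSum b _
        · exact tsum_tsum_mul_le_colSum c _
    _ = _ := by
        rw [ENNReal.mul_rpow_of_nonneg _ _ hφ, ENNReal.mul_rpow_of_nonneg _ _ hφ]
        simp only [← ENNReal.rpow_mul, mul_assoc, mul_inv_cancel₀ hq.ne', mul_one]
        rw [ENNReal.mul_rpow_of_nonneg _ _ hθ, ENNReal.mul_rpow_of_nonneg _ _ hθφ,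
          rpow_split (∑' u, x u ^ q) hθ hθφ (show q⁻¹ = θ + (q⁻¹ - θ) by ring)]
        ring

end Schur

/-! ### The matrix dominating the change of components. -/

section Amplification

variable {ι : Type} [DecidableEq ι] {γ : Finset ι → ℝ≥0}

/-- The matrix that bounds the weighted norms of the new components by those of the old ones, if
integrating out a variable enlarges norms by the factor `m`. -/
def amp (γ : Finset ι → ℝ≥0) (m : ℝ≥0∞) (v u : Finset ι) : ℝ≥0∞ :=
  if v ⊆ u then (γ v : ℝ≥0∞)⁻¹ * γ u * m ^ (u \ v).card else 0

lemma amp_interpolate (m l : ℝ≥0∞) {θ : ℝ} (hθ : 0 ≤ θ) (hθ' : θ ≤ 1) (v u : Finset ι) :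
    amp γ (m ^ θ * l ^ (1 - θ)) v u = amp γ m v u ^ θ * amp γ l v u ^ (1 - θ) := by
  have h1 : 0 ≤ 1 - θ := sub_nonneg.2 hθ'
  unfold amp
  split_ifs
  · have hpow : ∀ (y : ℝ≥0∞) (r : ℝ) (n : ℕ), (y ^ r) ^ n = (y ^ n) ^ r := fun y r n => by
      rw [← ENNReal.rpow_natCast, ← ENNReal.rpow_natCast, ← ENNReal.rpow_mul, ← ENNReal.rpow_mul,
        mul_comm]
    rw [ENNReal.mul_rpow_of_nonneg _ _ hθ, ENNReal.mul_rpow_of_nonneg _ _ h1, mul_pow, hpow, hpow]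
    nth_rewrite 1 [← ENNReal.rpow_one ((γ v : ℝ≥0∞)⁻¹ * γ u)]
    rw [rpow_split _ hθ h1 (show (1 : ℝ) = θ + (1 - θ) by ring)]
    ring
  -- Both entries are 0 here. At θ = 0 the first factor is 0 ^ 0 = 1, and the second one vanishes.
  · rcases hθ.eq_or_lt with rfl | hθ
    · simp
    · simp [hθ]

variable {D : Set ℝ} [SigmaFinite (volume : Measure D)] {ψ : D → ℝ}

omit [DecidableEq ι] [SigmaFinite (volume : Measure D)] in
lemma coeffNorm_eq_seqNorm (p₁ p₂ : ℝ≥0∞) (g : ∀ u : Finset ι, (u → D) → ℝ) :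
    coeffNorm ψ γ p₁ p₂ g =
      seqNorm p₂ fun u => (γ u : ℝ≥0∞)⁻¹ * eLpNorm (g u) p₁ (weightMeasure ψ u) := rfl

/-- Minkowski's inequality in L^{p₁}, with one factor `gain` for each coordinate integrated out. -/
lemma coeffNorm_transform_le (hψ : Measurable ψ) (hψ_pos : ∀ᵐ t, 0 < ψ t) {b : D → ℝ}
    (hb : Integrable (fun t => b t / ψ t) (weightedVolume ψ)) {p₁ p₂ : ℝ≥0∞} (hp₁ : 1 ≤ p₁)
    (hp₂ : 1 ≤ p₂) {g : ∀ u : Finset ι, (u → D) → ℝ} (A : Finset (Finset ι))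
    (hg : ∀ u, MemLp (g u) p₁ (weightMeasure ψ u)) (hfin : coeffNorm ψ γ p₁ p₂ g < ∞) :
    coeffNorm ψ γ p₁ p₂ (transform ψ b A g) ≤ seqNorm p₂ fun v => ∑' u,
      amp γ (gain (weightedVolume ψ) (fun t => b t / ψ t) p₁) v u *
        ((γ u : ℝ≥0∞)⁻¹ * eLpNorm (g u) p₁ (weightMeasure ψ u)) := by
  have := sigmaFinite_weightedVolume ψ
  rw [coeffNorm_eq_seqNorm] at hfin ⊢
  -- Cancellation of γ_u survives γ_u = 0, because finiteness of the coefficient norm then forces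
  -- ‖g_u‖ = 0.
  have hcancel : ∀ u, eLpNorm (g u) p₁ (weightMeasure ψ u) =
      γ u * ((γ u : ℝ≥0∞)⁻¹ * eLpNorm (g u) p₁ (weightMeasure ψ u)) := fun u => by
    have hu := (le_seqNorm hp₂ _ u).trans_lt hfin
    by_cases hγ : γ u = 0
    · rw [hγ] at hu ⊢
      simp only [ENNReal.coe_zero, ENNReal.inv_zero, zero_mul] at hu ⊢
      by_contra hne
      rw [ENNReal.top_mul hne] at hu
      exact absurd hu (lt_irrefl _)
    · rw [← mul_assoc, ENNReal.mul_inv_cancel (by simpa using hγ) ENNReal.coe_ne_top, one_mul]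
  refine seqNorm_mono fun v => ?_
  set m := gain (weightedVolume ψ) (fun t => b t / ψ t) p₁
  have hP : ∀ u ∈ A.filter (v ⊆ ·), AEStronglyMeasurable (partialIntegral (weightedVolume ψ)
      (fun x => b x / ψ x) v u (g u)) (weightMeasure ψ v) ∧
      eLpNorm (partialIntegral (weightedVolume ψ) (fun x => b x / ψ x) v u (g u)) p₁
        (weightMeasure ψ v) ≤ m ^ (u \ v).card * eLpNorm (g u) p₁ (weightMeasure ψ u) :=
    fun u hu => by
      have hvu := (Finset.mem_filter.1 hu).2
      have hgu := (hg u).1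
      rw [weightMeasure_eq_pi hψ hψ_pos] at hgu
      rw [weightMeasure_eq_pi hψ hψ_pos, weightMeasure_eq_pi hψ hψ_pos]
      exact ⟨aestronglyMeasurable_partialIntegral hvu hb.1 hgu,
        eLpNorm_partialIntegral_le hvu hb hp₁ hgu⟩
  have hsum : transform ψ b A g v = ∑ u ∈ A with v ⊆ u,
      partialIntegral (weightedVolume ψ) (fun x => b x / ψ x) v u (g u) := by
    ext t
    simp [transform]
  calc (γ v : ℝ≥0∞)⁻¹ * eLpNorm (transform ψ b A g v) p₁ (weightMeasure ψ v)
      ≤ (γ v : ℝ≥0∞)⁻¹ * ∑ u ∈ A with v ⊆ u,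
          m ^ (u \ v).card * eLpNorm (g u) p₁ (weightMeasure ψ u) := by
        gcongr
        rw [hsum]
        exact (eLpNorm_sum_le (fun u hu => (hP u hu).1) hp₁).trans
          (Finset.sum_le_sum fun u hu => (hP u hu).2)
    _ = ∑ u ∈ A with v ⊆ u, amp γ m v u *
          ((γ u : ℝ≥0∞)⁻¹ * eLpNorm (g u) p₁ (weightMeasure ψ u)) := by
        rw [Finset.mul_sum]
        refine Finset.sum_congr rfl fun u hu => ?_
        rw [amp, if_pos (Finset.mem_filter.1 hu).2]
        nth_rewrite 1 [hcancel u]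
        ring
    _ ≤ _ := ENNReal.sum_le_tsum _

end Amplification

/-! ### Functions that nearly attain the cost of integrating out a variable. -/

section TestFunctions

variable {Ω : Type*} [MeasurableSpace Ω] {μ : Measure Ω} [SigmaFinite μ] {β : Ω → ℝ}

/-- All tensor powers of `χ` have unit `L^p` norm. -/
def HasUnitPowers (μ : Measure Ω) (p : ℝ≥0∞) (χ : Ω → ℝ) : Prop :=
  ∀ (δ : Type) [Fintype δ], AEStronglyMeasurable (fun t : δ → Ω => ∏ j, χ (t j))
    (Measure.pi fun _ => μ) ∧ eLpNorm (fun t : δ → Ω => ∏ j, χ (t j)) p (Measure.pi fun _ => μ) = 1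

lemma gain_one (μ : Measure Ω) (β : Ω → ℝ) : gain μ β 1 = eLpNorm β ∞ μ := by
  simp [gain]

lemma gain_top (μ : Measure Ω) (β : Ω → ℝ) : gain μ β ∞ = eLpNorm β 1 μ := by
  simp [gain]

/-- The sign of `β`, with the value `1` where `β` vanishes. -/
def unitSign (β : Ω → ℝ) (x : Ω) : ℝ := if 0 ≤ β x then 1 else -1

omit [MeasurableSpace Ω] in
lemma unitSign_mul (β : Ω → ℝ) (x : Ω) : unitSign β x * β x = |β x| := by
  unfold unitSign
  split_ifs with h
  · rw [abs_of_nonneg h, one_mul]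
  · rw [abs_of_neg (not_le.1 h)]; ring

omit [MeasurableSpace Ω] in
lemma enorm_unitSign (β : Ω → ℝ) (x : Ω) : ‖unitSign β x‖ₑ = 1 := by
  unfold unitSign
  split_ifs <;> simp

lemma measurable_unitSign (hβ : Measurable β) : Measurable (unitSign β) :=
  Measurable.ite (measurableSet_le measurable_const hβ) measurable_const measurable_const

lemma hasUnitPowers_unitSign (hμ : μ ≠ 0) (hβ : Measurable β) :
    HasUnitPowers μ ∞ (unitSign β) := fun δ _ => by
  refine ⟨aestronglyMeasurable_prod_pi fun _ => (measurable_unitSign hβ).aestronglyMeasurable, ?_⟩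
  have hne : (Measure.pi fun _ : δ => μ) ≠ 0 := by
    rw [Ne, ← Measure.measure_univ_eq_zero, Measure.pi_univ, Finset.prod_eq_zero_iff]
    simpa using fun _ => hμ
  rw [eLpNorm_congr_enorm_ae (g := fun _ => (1 : ℝ)) (Eventually.of_forall fun t => by
    simp [enorm_eq_nnnorm, nnnorm_prod, ENNReal.ofNNReal_finsetProd]
    simp [← enorm_eq_nnnorm, enorm_unitSign])]
  rw [eLpNorm_const _ ENNReal.top_ne_zero hne]
  simp

lemma hasUnitPowers_one {χ : Ω → ℝ} (hχ : Integrable χ μ) (h1 : eLpNorm χ 1 μ = 1) :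
    HasUnitPowers μ 1 χ := fun δ _ =>
  ⟨aestronglyMeasurable_prod_pi fun _ => hχ.1, by
    rw [eLpNorm_one_prod_pi fun _ => hχ]; simp [h1]⟩

/-- Take χ = sign(β)/μ(F) on a set F of positive finite measure inside {|β| ≥ ‖β‖_∞ - ε}; then ∫ χβ
is the average of |β| over F. -/
lemma exists_concentrated (hμ : μ ≠ 0) (hβ : Measurable β) (hβ' : MemLp β ∞ μ) {ε : ℝ}
    (hε : 0 < ε) : ∃ χ, HasUnitPowers μ 1 χ ∧ 0 ≤ ∫ x, χ x * β x ∂μ ∧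
      (eLpNorm β ∞ μ).toReal - ε ≤ ∫ x, χ x * β x ∂μ ∧
      ∫ x, χ x * β x ∂μ ≤ (eLpNorm β ∞ μ).toReal := by
  set M := (eLpNorm β ∞ μ).toReal with hM
  set E := {x | M - ε ≤ |β x|}
  have hE : MeasurableSet E := measurableSet_le measurable_const hβ.abs
  have hEpos : μ E ≠ 0 := by
    intro h0
    have hae : ∀ᵐ x ∂μ, |β x| ≤ M - ε := by
      have : ∀ᵐ x ∂μ, x ∉ E := measure_eq_zero_iff_ae_notMem.1 h0
      filter_upwards [this] with x hx
      exact (not_le.1 hx).le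
    by_cases hneg : M - ε < 0
    · have : ∀ᵐ x ∂μ, False := by
        filter_upwards [hae] with x hx
        linarith [abs_nonneg (β x)]
      rw [eventually_false_iff_eq_bot, ae_eq_bot] at this
      exact hμ this
    · have h1 : eLpNorm β ∞ μ ≤ ENNReal.ofReal (M - ε) := by
        rw [eLpNorm_exponent_top]
        refine essSup_le_of_ae_le _ ?_
        filter_upwards [hae] with x hx
        rw [Real.enorm_eq_ofReal_abs]
        exact ENNReal.ofReal_le_ofReal hx
      have h2 := ENNReal.toReal_mono ENNReal.ofReal_ne_top h1
      rw [ENNReal.toReal_ofReal (not_lt.1 hneg)] at h2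
      linarith
  obtain ⟨F, hF, hFE, hFpos, hFtop⟩ :=
    Measure.exists_subset_measure_lt_top hE (pos_iff_ne_zero.2 hEpos)
  have hr : 0 < μ.real F := ENNReal.toReal_pos hFpos.ne' hFtop.ne
  set χ : Ω → ℝ := F.indicator fun x => (μ.real F)⁻¹ * unitSign β x
  have hFin : IsFiniteMeasure (μ.restrict F) := ⟨by simpa using hFtop⟩
  have hbound : ∀ᵐ x ∂μ, |β x| ≤ M := by
    have : ∀ᵐ x ∂μ, ‖β x‖ₑ ≤ eLpNorm β ∞ μ := by
      rw [eLpNorm_exponent_top]; exact ae_le_eLpNormEssSup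
    filter_upwards [this] with x hx
    simpa [hM] using ENNReal.toReal_mono hβ'.2.ne hx
  have hint : IntegrableOn (fun x => |β x|) F μ :=
    Integrable.of_bound hβ.abs.aestronglyMeasurable M (ae_restrict_of_ae (by
      filter_upwards [hbound] with x hx
      simpa using hx))
  have hχβ : ∫ x, χ x * β x ∂μ = (μ.real F)⁻¹ * ∫ x in F, |β x| ∂μ := by
    rw [← integral_const_mul, ← integral_indicator hF]
    refine integral_congr_ae (Eventually.of_forall fun x => ?_)
    by_cases hx : x ∈ F
    · simp [χ, hx, mul_assoc, unitSign_mul]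
    · simp [χ, hx]
  have hχ : Integrable χ μ := by
    rw [integrable_indicator_iff hF]
    refine Integrable.const_mul ?_ _
    refine Integrable.of_bound (measurable_unitSign hβ).aestronglyMeasurable 1
      (Eventually.of_forall fun x => ?_)
    unfold unitSign
    split_ifs <;> simp
  refine ⟨χ, hasUnitPowers_one hχ ?_, ?_, ?_, ?_⟩
  · rw [eLpNorm_one_eq_lintegral_enorm]
    simp only [χ, enorm_indicator_eq_indicator_enorm]
    rw [lintegral_indicator hF]
    simp only [enorm_mul, enorm_unitSign, mul_one, lintegral_const, Measure.restrict_apply,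
      MeasurableSet.univ, Set.univ_inter]
    rw [Real.enorm_eq_ofReal (by positivity), ENNReal.ofReal_inv_of_pos hr, ofReal_measureReal
      hFtop.ne, ENNReal.inv_mul_cancel hFpos.ne' hFtop.ne]
  · rw [hχβ]; positivity
  · rw [hχβ, le_inv_mul_iff₀ hr]
    calc μ.real F * (M - ε) = ∫ _ in F, (M - ε) ∂μ := by simp
      _ ≤ _ := setIntegral_mono_on (integrable_const _) hint hF fun x hx => hFE hx
  · rw [hχβ, inv_mul_le_iff₀ hr]
    calc ∫ x in F, |β x| ∂μ ≤ ∫ _ in F, M ∂μ :=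
          integral_mono_ae hint (integrable_const _) (ae_restrict_of_ae hbound)
      _ = _ := by simp

/-- For p = 1 the essential supremum need not be attained, hence a sequence; for p = ∞ the sign of β
attains ‖β‖_1. -/
lemma exists_testFunctions (hμ : μ ≠ 0) (hβ : Measurable β) (hβi : Integrable β μ)
    (hβ' : MemLp β ∞ μ) {p : ℝ≥0∞} (hp : p = 1 ∨ p = ∞) :
    ∃ χ : ℕ → Ω → ℝ, (∀ n, HasUnitPowers μ p (χ n)) ∧ (∀ n, 0 ≤ ∫ x, χ n x * β x ∂μ) ∧
      Tendsto (fun n => ENNReal.ofReal (∫ x, χ n x * β x ∂μ)) atTop (nhds (gain μ β p)) := by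
  rcases hp with rfl | rfl
  · choose χ hχ h0 hlow hup using fun n : ℕ =>
      exists_concentrated hμ hβ hβ' (ε := 1 / ((n : ℝ) + 1)) (by positivity)
    refine ⟨χ, hχ, h0, ?_⟩
    rw [gain_one, ← ENNReal.ofReal_toReal hβ'.2.ne]
    refine ENNReal.tendsto_ofReal (tendsto_of_tendsto_of_tendsto_of_le_of_le ?_
      tendsto_const_nhds hlow hup)
    simpa using tendsto_const_nhds.sub (tendsto_one_div_add_atTop_nhds_zero_nat (𝕜 := ℝ))
  · refine ⟨fun _ => unitSign β, fun _ => hasUnitPowers_unitSign hμ hβ, fun _ => ?_, ?_⟩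
    · simp only [unitSign_mul]
      exact integral_nonneg fun _ => abs_nonneg _
    · simp only [unitSign_mul]
      rw [gain_top, eLpNorm_one_eq_lintegral_enorm, ← ofReal_integral_norm_eq_lintegral_enorm hβi]
      exact tendsto_const_nhds

end TestFunctions

/-! ### Embedding norms compared with row and column sums. -/

section LowerBounds

variable {D : Set ℝ} [SigmaFinite (volume : Measure D)] {ι : Type} [DecidableEq ι] {ψ : D → ℝ}
  {γ : Finset ι → ℝ≥0}

/-- `κ` is anchored at `a`, and differs by `b(t)` from `k'`, with the integrability in `t` that the
operators on `L_{u,p,ψ}` require. -/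
structure IsShift (ψ : D → ℝ) (a : D) (κ k' : D → D → ℝ) (b : D → ℝ) : Prop where
  measurable_weight : Measurable ψ
  weight_pos : ∀ᵐ t, 0 < ψ t
  anchored : ∀ t, κ a t = 0
  eq_add : ∀ x t, κ x t = k' x t + b t
  measurable_shift : Measurable b
  integrable_shift : Integrable (fun t => b t / ψ t) (weightedVolume ψ)
  memLp_top_shift : MemLp (fun t => b t / ψ t) ∞ (weightedVolume ψ)

variable {a : D} {κ k' : D → D → ℝ} {b : D → ℝ}

omit [SigmaFinite (volume : Measure D)] in
lemma IsShift.memLp (h : IsShift ψ a κ k' b) {q : ℝ≥0∞} (hq : 1 ≤ q)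
    (hk : ∀ x, MemLp (fun t => κ x t / ψ t) q (weightedVolume ψ)) (x : D) :
    MemLp (fun t => k' x t / ψ t) q (weightedVolume ψ) := by
  have h1 := (hk x).sub
    (memLp_of_integrable_of_memLp_top h.integrable_shift h.memLp_top_shift hq)
  refine h1.ae_eq (Eventually.of_forall fun t => ?_)
  simp only [Pi.sub_apply, h.eq_add]
  ring

lemma IsShift.embeddingNorm_le (h : IsShift ψ a κ k' b) {p₁ p₂ : ℝ≥0∞} (hp₁ : 1 ≤ p₁)
    (hp₂ : 1 ≤ p₂) (hk : ∀ x, MemLp (fun t => κ x t / ψ t) p₁.conjExponent (weightedVolume ψ))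
    {C : ℝ≥0∞} (hC : ∀ x : Finset ι → ℝ≥0∞, seqNorm p₂ (fun v => ∑' u,
      amp γ (gain (weightedVolume ψ) (fun t => b t / ψ t) p₁) v u * x u) ≤ C * seqNorm p₂ x) :
    embeddingNorm (spaceNorm κ ψ γ p₁ p₂) (spaceNorm k' ψ γ p₁ p₂) ≤ C := by
  refine WeightedSpaces.embeddingNorm_le fun hC' f hf =>
    spaceNorm_le_mul hC' (fun f g hfg hg => ?_) hf
  obtain ⟨hg1, A, -, hfA⟩ := hfg
  have hT := represents_transform h.measurable_weight h.weight_pos h.eq_add h.integrable_shift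
    h.memLp_top_shift hp₁ (h.memLp (by simp [ENNReal.conjExponent]) hk) hg1 hfA
  exact (iInf₂_le _ hT).trans ((coeffNorm_transform_le h.measurable_weight h.weight_pos
    h.integrable_shift hp₁ hp₂ A hg1 hg).trans (hC _))

lemma IsShift.le_embeddingNorm (h : IsShift ψ a κ k' b) {p₁ p₂ : ℝ≥0∞} (hp₁ : 1 ≤ p₁)
    (hp₂ : 1 ≤ p₂) (hk : ∀ x, MemLp (fun t => κ x t / ψ t) p₁.conjExponent (weightedVolume ψ))
    (hκ : Admissible ι ψ κ p₁) {g : ∀ u : Finset ι, (u → D) → ℝ} {A : Finset (Finset ι)}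
    (hg : ∀ u, MemLp (g u) p₁ (weightMeasure ψ u)) (hA : ∀ u, u ∉ A → g u = 0)
    (hg1 : coeffNorm ψ γ p₁ p₂ g ≤ 1) :
    coeffNorm ψ γ p₁ p₂ (transform ψ b A g) ≤
      embeddingNorm (spaceNorm κ ψ γ p₁ p₂) (spaceNorm k' ψ γ p₁ p₂) := by
  have hk' := h.memLp (q := p₁.conjExponent) (by simp [ENNReal.conjExponent]) hk
  set f : (ι → D) → ℝ := fun x => ∑ u ∈ A, K κ u (g u) fun j => x j
  have hM : spaceNorm κ ψ γ p₁ p₂ f ≤ 1 := (iInf₂_le g ⟨hg, A, hA, fun _ => rfl⟩).trans hg1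
  have hT : Represents k' ψ p₁ f (transform ψ b A g) := represents_transform h.measurable_weight
    h.weight_pos h.eq_add h.integrable_shift h.memLp_top_shift hp₁ hk' hg fun _ => rfl
  -- By uniqueness, all representations of f have a.e. equal components, so the infimum is over a
  -- single value.
  have hN : coeffNorm ψ γ p₁ p₂ (transform ψ b A g) ≤ spaceNorm k' ψ γ p₁ p₂ f := by
    refine le_iInf₂ fun g' hg' => (coeffNorm_congr fun u => ?_).le
    have hsub := hT.sub h.measurable_weight h.weight_pos hp₁ hk' hg'
    rw [sub_self] at hsub
    filter_upwards [hsub.ae_eq_zero h.measurable_weight h.weight_pos h.anchored hp₁ hκ hk h.eq_add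
      h.integrable_shift h.memLp_top_shift u] with t ht
    exact sub_eq_zero.1 ht
  refine WeightedSpaces.le_embeddingNorm (spaceNorm_zero hp₂) (hM.trans_lt ENNReal.one_lt_top)
    fun C hC => hN.trans (hC.trans ?_)
  calc C * spaceNorm κ ψ γ p₁ p₂ f ≤ C * 1 := by gcongr
    _ = C := mul_one C

omit [DecidableEq ι] in
lemma eLpNorm_const_mul_prod {p : ℝ≥0∞} {χ : D → ℝ} (hψ : Measurable ψ)
    (hψ_pos : ∀ᵐ t, 0 < ψ t) (hχ : HasUnitPowers (weightedVolume ψ) p χ) (u : Finset ι) {c : ℝ}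
    (hc : 0 ≤ c) :
    MemLp (fun t : u → D => c * ∏ j, χ (t j)) p (weightMeasure ψ u) ∧
      eLpNorm (fun t : u → D => c * ∏ j, χ (t j)) p (weightMeasure ψ u) = ENNReal.ofReal c := by
  rw [weightMeasure_eq_pi hψ hψ_pos]
  obtain ⟨h1, h2⟩ := hχ u
  have h3 : eLpNorm (fun t : u → D => c * ∏ j, χ (t j)) p
      (Measure.pi fun _ => weightedVolume ψ) = ENNReal.ofReal c := by
    refine (eLpNorm_const_smul c (fun t : u → D => ∏ j, χ (t j)) p _).trans ?_
    rw [h2, mul_one, Real.enorm_eq_ofReal hc]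
  exact ⟨⟨h1.const_mul c, h3 ▸ ENNReal.ofReal_lt_top⟩, h3⟩

/-- The test components γ_u χ^{⊗u}, u ∈ A, have weighted norm at most 1. Each new component is a
multiple of χ^{⊗v}, and ∫ χβ ≥ 0 excludes cancellation, so its norm is an exact sum of matrix
entries. -/
lemma IsShift.seqNorm_amp_le (h : IsShift ψ a κ k' b) {p₁ p₂ : ℝ≥0∞} (hp₁ : 1 ≤ p₁)
    (hp₂ : 1 ≤ p₂) (hk : ∀ x, MemLp (fun t => κ x t / ψ t) p₁.conjExponent (weightedVolume ψ))
    (hκ : Admissible ι ψ κ p₁) {χ : D → ℝ} (hχ : HasUnitPowers (weightedVolume ψ) p₁ χ)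
    (hχ0 : 0 ≤ ∫ x, χ x * (b x / ψ x) ∂weightedVolume ψ) (A : Finset (Finset ι))
    (hA : seqNorm p₂ (fun u => if u ∈ A then 1 else 0) ≤ 1) :
    seqNorm p₂ (fun v => ∑ u ∈ A,
        amp γ (ENNReal.ofReal (∫ x, χ x * (b x / ψ x) ∂weightedVolume ψ)) v u) ≤
      embeddingNorm (spaceNorm κ ψ γ p₁ p₂) (spaceNorm k' ψ γ p₁ p₂) := by
  have := sigmaFinite_weightedVolume ψ
  set c := ∫ x, χ x * (b x / ψ x) ∂weightedVolume ψ
  set g : ∀ u : Finset ι, (u → D) → ℝ := fun u t => (if u ∈ A then (γ u : ℝ) else 0) * ∏ j, χ (t j)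
  have hgn := fun u : Finset ι => eLpNorm_const_mul_prod h.measurable_weight h.weight_pos hχ u
    (c := if u ∈ A then (γ u : ℝ) else 0) (by split_ifs <;> simp)
  have hg0 : ∀ u, u ∉ A → g u = 0 := fun u hu => by ext t; simp [g, hu]
  have hg1 : coeffNorm ψ γ p₁ p₂ g ≤ 1 := by
    refine le_trans (seqNorm_mono fun u => ?_) hA
    rw [(hgn u).2]
    split_ifs
    · simp [ENNReal.inv_mul_le_one]
    · simp
  refine le_trans (seqNorm_mono fun v => ?_)
    (h.le_embeddingNorm hp₁ hp₂ hk hκ (fun u => (hgn u).1) hg0 hg1)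
  have htr : transform ψ b A g v = fun t =>
      (∑ u ∈ A with v ⊆ u, (γ u : ℝ) * c ^ (u \ v).card) * ∏ j, χ (t j) := by
    ext t
    rw [transform, Finset.sum_mul]
    refine Finset.sum_congr rfl fun u hu => ?_
    obtain ⟨huA, hvu⟩ := Finset.mem_filter.1 hu
    have := partialIntegral_prod (μ := weightedVolume ψ) hvu (fun x => b x / ψ x) χ (γ u) t
    simpa only [g, huA, if_true] using this
  rw [htr, (eLpNorm_const_mul_prod h.measurable_weight h.weight_pos hχ v
    (Finset.sum_nonneg fun u _ => by positivity)).2,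
    ENNReal.ofReal_sum_of_nonneg fun u _ => by positivity, Finset.mul_sum, Finset.sum_filter]
  refine Finset.sum_le_sum fun u _ => ?_
  unfold amp
  split_ifs
  · rw [ENNReal.ofReal_mul (by positivity), ENNReal.ofReal_pow hχ0, ENNReal.ofReal_coe_nnreal,
      mul_assoc]
  · exact le_rfl

lemma tendsto_amp (hγ : ∀ u v, v ⊆ u → 0 < γ u → 0 < γ v) {m : ℕ → ℝ≥0∞} {l : ℝ≥0∞}
    (hm : Tendsto m atTop (nhds l)) (v u : Finset ι) :
    Tendsto (fun n => amp γ (m n) v u) atTop (nhds (amp γ l v u)) := by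
  unfold amp
  split_ifs with hvu
  · refine ENNReal.Tendsto.const_mul (ENNReal.Tendsto.pow hm) (Or.inr ?_)
    -- Multiplication by γ_v⁻¹ γ_u is continuous if this factor is finite. When γ_v = 0, the
    -- hypothesis on the weights gives γ_u = 0, and the factor is ∞ * 0 = 0.
    by_cases hv : γ v = 0
    · have : γ u = 0 := by
        by_contra hu
        exact (hγ u v hvu (pos_iff_ne_zero.2 hu)).ne' hv
      simp [this]
    · exact ENNReal.mul_ne_top (by simpa using hv) ENNReal.coe_ne_top
  · exact tendsto_const_nhds

/-- In ℓ^∞ the indicator of any finite set of indices has norm at most 1, so one test function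
reaches an arbitrary finite part of a row. -/
lemma IsShift.rowSum_amp_le (h : IsShift ψ a κ k' b) (hD : weightedVolume ψ ≠ 0)
    (hγ : ∀ u v, v ⊆ u → 0 < γ u → 0 < γ v) {p : ℝ≥0∞} (hp : p = 1 ∨ p = ∞)
    (hk : ∀ x, MemLp (fun t => κ x t / ψ t) p.conjExponent (weightedVolume ψ))
    (hκ : Admissible ι ψ κ p) :
    rowSum (amp γ (gain (weightedVolume ψ) (fun t => b t / ψ t) p)) ≤
      embeddingNorm (spaceNorm κ ψ γ p ∞) (spaceNorm k' ψ γ p ∞) := by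
  have := sigmaFinite_weightedVolume ψ
  have hp1 : 1 ≤ p := by rcases hp with rfl | rfl <;> simp
  obtain ⟨χ, hχ, hχ0, hlim⟩ := exists_testFunctions hD
    (h.measurable_shift.div h.measurable_weight) h.integrable_shift h.memLp_top_shift hp
  refine iSup_le fun v => ?_
  rw [ENNReal.tsum_eq_iSup_sum]
  refine iSup_le fun A => le_of_tendsto (tendsto_finsetSum A fun u _ => tendsto_amp hγ hlim v u)
    (Eventually.of_forall fun n => ?_)
  refine le_trans ?_ (h.seqNorm_amp_le hp1 le_top hk hκ (hχ n) (hχ0 n) A ?_)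
  · exact le_seqNorm le_top (fun v => ∑ u ∈ A, amp γ _ v u) v
  · simp only [seqNorm, if_true]
    exact iSup_le fun u => by split_ifs <;> simp

/-- In ℓ^1 a single index u is tested, and the ℓ^1 norm of the image sums column u. -/
lemma IsShift.colSum_amp_le (h : IsShift ψ a κ k' b) (hD : weightedVolume ψ ≠ 0)
    (hγ : ∀ u v, v ⊆ u → 0 < γ u → 0 < γ v) {p : ℝ≥0∞} (hp : p = 1 ∨ p = ∞)
    (hk : ∀ x, MemLp (fun t => κ x t / ψ t) p.conjExponent (weightedVolume ψ))
    (hκ : Admissible ι ψ κ p) :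
    colSum (amp γ (gain (weightedVolume ψ) (fun t => b t / ψ t) p)) ≤
      embeddingNorm (spaceNorm κ ψ γ p 1) (spaceNorm k' ψ γ p 1) := by
  have := sigmaFinite_weightedVolume ψ
  have hp1 : 1 ≤ p := by rcases hp with rfl | rfl <;> simp
  obtain ⟨χ, hχ, hχ0, hlim⟩ := exists_testFunctions hD
    (h.measurable_shift.div h.measurable_weight) h.integrable_shift h.memLp_top_shift hp
  refine iSup_le fun u => ?_
  rw [ENNReal.tsum_eq_iSup_sum]
  refine iSup_le fun B => le_of_tendsto (tendsto_finsetSum B fun v _ => tendsto_amp hγ hlim v u)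
    (Eventually.of_forall fun n => ?_)
  refine le_trans ?_ (h.seqNorm_amp_le hp1 le_rfl hk hκ (hχ n) (hχ0 n) {u} ?_)
  · simp only [seqNorm, ENNReal.one_ne_top, if_false, ENNReal.toReal_one, ENNReal.rpow_one,
      one_div, inv_one, Finset.sum_singleton]
    exact ENNReal.sum_le_tsum B
  · simp [seqNorm]

end LowerBounds

/-! ### The shift by the ω-mean, bounded through κ̄_{1,ω} and κ̄_{∞,ω}. -/

section Centered

variable {D : Set ℝ} {ψ ω : D → ℝ} {κ : D → D → ℝ}

lemma enorm_mean_div_le (hω : ∀ x, 0 ≤ ω x) (p : ℝ≥0∞) {t : D} (ht : 0 < ψ t) :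
    ‖(∫ y, κ y t * ω y) / ψ t ^ (p⁻¹).toReal‖ₑ ≤ kappaBar ψ ω κ p t := by
  rw [← integral_div]
  refine (enorm_integral_le_lintegral_enorm _).trans_eq ?_
  refine lintegral_congr fun x => ?_
  have : 0 < ψ t ^ (p⁻¹).toReal := Real.rpow_pos_of_pos ht _
  rw [Real.enorm_eq_ofReal_abs, abs_div, abs_mul, abs_of_pos this, abs_of_nonneg (hω x)]
  congr 1
  ring

lemma eLpNorm_top_mean_div_le (hψ_pos : ∀ᵐ t, 0 < ψ t) (hω : ∀ x, 0 ≤ ω x) :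
    eLpNorm (fun t => (∫ y, κ y t * ω y) / ψ t) ∞ (weightedVolume ψ) ≤
      kappaBarNorm ψ ω κ 1 := by
  rw [kappaBarNorm, show ENNReal.conjExponent 1 = ∞ by simp [ENNReal.conjExponent],
    eLpNorm_exponent_top]
  refine (eLpNormEssSup_mono_measure _ weightedVolume_absolutelyContinuous).trans ?_
  rw [← eLpNorm_exponent_top]
  refine eLpNorm_mono_enorm_ae ?_
  filter_upwards [hψ_pos] with t ht
  simpa using enorm_mean_div_le (κ := κ) hω 1 ht

lemma eLpNorm_one_mean_div_le (hψ : Measurable ψ) (hψ_pos : ∀ᵐ t, 0 < ψ t)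
    (hω : ∀ x, 0 ≤ ω x) (hb : Measurable fun t => ∫ y, κ y t * ω y) :
    eLpNorm (fun t => (∫ y, κ y t * ω y) / ψ t) 1 (weightedVolume ψ) ≤
      kappaBarNorm ψ ω κ ∞ := by
  have hm : Measurable fun t => (∫ y, κ y t * ω y) / ψ t := hb.div hψ
  rw [kappaBarNorm, show ENNReal.conjExponent ∞ = 1 by simp [ENNReal.conjExponent],
    eLpNorm_one_eq_lintegral_enorm, eLpNorm_one_eq_lintegral_enorm, weightedVolume,
    lintegral_withDensity_eq_lintegral_mul _ hψ.ennreal_ofReal hm.enorm]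
  refine lintegral_mono_ae ?_
  filter_upwards [hψ_pos] with t ht
  have h1 := enorm_mean_div_le (κ := κ) hω ∞ ht
  simp only [ENNReal.inv_top, ENNReal.toReal_zero, Real.rpow_zero, div_one] at h1
  refine le_trans (le_of_eq ?_) h1
  rw [Pi.mul_apply, ← Real.enorm_of_nonneg ht.le, ← enorm_mul]
  congr 1
  field_simp

variable [SigmaFinite (volume : Measure D)]

lemma isShift_centered (hψ : Measurable ψ) (hψ_pos : ∀ᵐ t, 0 < ψ t) (hω_meas : Measurable ω)
    (hω : ∀ x, 0 ≤ ω x) (hκ_meas : Measurable (Function.uncurry κ)) {a : D}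
    (ha : ∀ t, κ a t = 0) (h1 : kappaBarNorm ψ ω κ 1 < ∞) (htop : kappaBarNorm ψ ω κ ∞ < ∞) :
    IsShift ψ a κ (centered ω κ) fun t => ∫ y, κ y t * ω y := by
  have hb : Measurable fun t => ∫ y, κ y t * ω y := by
    have : StronglyMeasurable (Function.uncurry fun y t => κ y t * ω y) :=
      (hκ_meas.mul (hω_meas.comp measurable_fst)).stronglyMeasurable
    exact this.integral_prod_left.measurable
  have hm : AEStronglyMeasurable (fun t => (∫ y, κ y t * ω y) / ψ t) (weightedVolume ψ) :=
    (hb.div hψ).aestronglyMeasurable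
  exact ⟨hψ, hψ_pos, ha, fun x t => by simp [centered], hb,
    memLp_one_iff_integrable.1 ⟨hm, (eLpNorm_one_mean_div_le hψ hψ_pos hω hb).trans_lt htop⟩,
    ⟨hm, (eLpNorm_top_mean_div_le hψ_pos hω).trans_lt h1⟩⟩

omit [SigmaFinite (volume : Measure D)] in
-- The existence of a probability density rules out an interval D of length zero.
lemma weightedVolume_ne_zero (hψ : Measurable ψ) (hψ_pos : ∀ᵐ t, 0 < ψ t)
    (hω_one : ∫⁻ x, ENNReal.ofReal (ω x) = 1) : weightedVolume ψ ≠ 0 := by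
  intro h
  have h1 : ∀ᵐ _ : D, False := (ae_weightedVolume_iff hψ hψ_pos).1 (by simp [h])
  rw [eventually_false_iff_eq_bot, ae_eq_bot] at h1
  simp [h1] at hω_one

end Centered

/-! ### Row and column sums for product weights. -/

section ProductWeights

variable {ι : Type} [DecidableEq ι] {γ : Finset ι → ℝ≥0} {c : ι → ℝ≥0}

/-- Only an inequality, since γ_v⁻¹ γ_v = 0 when γ_v = 0. -/
lemma amp_le_prod (hγ : ∀ u, γ u = ∏ j ∈ u, c j) (m : ℝ≥0∞) {v u : Finset ι} (hvu : v ⊆ u) :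
    amp γ m v u ≤ ∏ j ∈ u \ v, c j * m := by
  rw [amp, if_pos hvu, Finset.prod_mul_distrib, Finset.prod_const]
  gcongr
  rw [hγ u, ← Finset.prod_sdiff hvu, ← hγ v, ENNReal.coe_mul, mul_comm, mul_assoc,
    ENNReal.ofNNReal_finsetProd]
  exact mul_le_of_le_one_right' (ENNReal.mul_inv_le_one _)

/-- The sets w(i) are distinct subsets of their union J, and ∏_{j ∈ J} (1 + f_j) expands into the
sum over all subsets of J. -/
lemma sum_prod_image_le {δ : Type*} (f : ι → ℝ≥0∞) (B : Finset δ) (w : δ → Finset ι)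
    (hw : Set.InjOn w B) :
    ∑ i ∈ B, ∏ j ∈ w i, f j ≤ ⨆ J : Finset ι, ∏ j ∈ J, (1 + f j) := by
  rw [← Finset.sum_image (f := fun s => ∏ j ∈ s, f j) hw]
  refine le_trans ?_ (le_iSup _ ((B.image w).sup id))
  rw [Finset.prod_one_add]
  exact Finset.sum_le_sum_of_subset fun s hs => Finset.mem_powerset.2 (Finset.le_sup (f := id) hs)

lemma rowSum_amp_le_iSup (hγ : ∀ u, γ u = ∏ j ∈ u, c j) (m : ℝ≥0∞) :
    rowSum (amp γ m) ≤ ⨆ J : Finset ι, ∏ j ∈ J, (1 + c j * m) := by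
  refine iSup_le fun v => ?_
  rw [ENNReal.tsum_eq_iSup_sum]
  refine iSup_le fun A => ?_
  calc ∑ u ∈ A, amp γ m v u = ∑ u ∈ A with v ⊆ u, amp γ m v u := by
        rw [Finset.sum_filter]
        exact Finset.sum_congr rfl fun u _ => by unfold amp; split_ifs <;> rfl
    _ ≤ ∑ u ∈ A with v ⊆ u, ∏ j ∈ u \ v, c j * m :=
        Finset.sum_le_sum fun u hu => amp_le_prod hγ m (Finset.mem_filter.1 hu).2
    _ ≤ _ := sum_prod_image_le _ _ (fun u => u \ v) fun u hu u' hu' h => by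
        have h1 := (Finset.mem_filter.1 hu).2
        have h2 := (Finset.mem_filter.1 hu').2
        rw [← Finset.sdiff_union_of_subset h1, ← Finset.sdiff_union_of_subset h2]
        exact congrArg (· ∪ v) h

lemma colSum_amp_le_iSup (hγ : ∀ u, γ u = ∏ j ∈ u, c j) (m : ℝ≥0∞) :
    colSum (amp γ m) ≤ ⨆ J : Finset ι, ∏ j ∈ J, (1 + c j * m) := by
  refine iSup_le fun u => ?_
  rw [ENNReal.tsum_eq_iSup_sum]
  refine iSup_le fun B => ?_
  calc ∑ v ∈ B, amp γ m v u = ∑ v ∈ B with v ⊆ u, amp γ m v u := by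
        rw [Finset.sum_filter]
        exact Finset.sum_congr rfl fun v _ => by unfold amp; split_ifs <;> rfl
    _ ≤ ∑ v ∈ B with v ⊆ u, ∏ j ∈ u \ v, c j * m :=
        Finset.sum_le_sum fun v hv => amp_le_prod hγ m (Finset.mem_filter.1 hv).2
    _ ≤ _ := sum_prod_image_le _ _ (fun v => u \ v) fun v hv v' hv' h => by
        rw [← Finset.sdiff_sdiff_eq_self (Finset.mem_filter.1 hv).2,
          ← Finset.sdiff_sdiff_eq_self (Finset.mem_filter.1 hv').2]
        exact congrArg (u \ ·) h

omit [DecidableEq ι] in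
lemma tendsto_prod_iSup {f : ι → ℝ≥0∞} (hf : ∀ j, 1 ≤ f j) :
    Tendsto (fun J : Finset ι => ∏ j ∈ J, f j) atTop (nhds (⨆ J : Finset ι, ∏ j ∈ J, f j)) :=
  tendsto_atTop_iSup fun _ _ h => Finset.prod_le_prod_of_subset_of_one_le' h fun j _ _ => hf j

omit [DecidableEq ι] in
-- Both suprema are limits of partial products. Being at least 1, they avoid the discontinuity of
-- multiplication at 0 · ∞.
lemma iSup_prod_rpow_mul {f g : ι → ℝ≥0∞} (hf : ∀ j, 1 ≤ f j) (hg : ∀ j, 1 ≤ g j) {a b : ℝ}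
    (ha : 0 ≤ a) (hb : 0 ≤ b) :
    (⨆ J : Finset ι, ∏ j ∈ J, f j) ^ a * (⨆ J : Finset ι, ∏ j ∈ J, g j) ^ b =
      ∏' j, f j ^ a * g j ^ b := by
  have hne : ∀ (h : ι → ℝ≥0∞) (r : ℝ), 0 ≤ r → (⨆ J : Finset ι, ∏ j ∈ J, h j) ^ r ≠ 0 :=
    fun h r hr => by
      have h1 : 1 ≤ ⨆ J : Finset ι, ∏ j ∈ J, h j := by
        simpa using le_iSup (fun J : Finset ι => ∏ j ∈ J, h j) ∅
      exact (zero_lt_one.trans_le (by simpa using ENNReal.rpow_le_rpow h1 hr)).ne'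
  have h1 := (ENNReal.continuous_rpow_const (y := a)).continuousAt.tendsto.comp
    (tendsto_prod_iSup hf)
  have h2 := (ENNReal.continuous_rpow_const (y := b)).continuousAt.tendsto.comp
    (tendsto_prod_iSup hg)
  have h3 := ENNReal.Tendsto.mul h1 (Or.inl (hne f a ha)) h2 (Or.inl (hne g b hb))
  have : HasProd (fun j => f j ^ a * g j ^ b)
      ((⨆ J : Finset ι, ∏ j ∈ J, f j) ^ a * (⨆ J : Finset ι, ∏ j ∈ J, g j) ^ b) := by
    refine h3.congr fun J => ?_
    simp only [Function.comp_apply, Finset.prod_mul_distrib,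
      ENNReal.prod_rpow_of_nonneg ha, ENNReal.prod_rpow_of_nonneg hb]
  exact this.tprod_eq.symm

end ProductWeights

end WeightedSpaces

end

/-! ### Assembly of the corollary. -/

open WeightedSpaces in
theorem mainTheorem5
    (D : Set ℝ) (hD : D.OrdConnected) (h0 : (0 : ℝ) ∈ D)
    (ψ : D → ℝ) (hψ_meas : Measurable ψ) (hψ_pos : ∀ᵐ t, 0 < ψ t)
    (ω : D → ℝ) (hω_meas : Measurable ω) (hω_nonneg : ∀ x, 0 ≤ ω x)
    (hω_one : ∫⁻ x, ENNReal.ofReal (ω x) = 1)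
    (κ : D → D → ℝ) (hκ_meas : Measurable (Function.uncurry κ))
    (hκ_anchor : ∀ t, κ ⟨0, h0⟩ t = 0)
    (hκ_bar : ∀ p : ℝ≥0∞, 1 ≤ p → kappaBarNorm ψ ω κ p < ∞)
    (s : ℕ∞) (p₁ p₂ : ℝ≥0∞) (hp₁ : 1 ≤ p₁) (hp₂ : 1 ≤ p₂)
    (hκ_one : Admissible (Coord s) ψ κ 1)
    (hκ_p₁ : Admissible (Coord s) ψ κ p₁)
    (hκ_top : Admissible (Coord s) ψ κ ∞)
    (γ : Finset (Coord s) → ℝ≥0) (hγ : ∀ u v, v ⊆ u → 0 < γ u → 0 < γ v) :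
    (p₁ ≤ p₂ →
      embNorm ψ ω κ γ p₁ p₂ ≤
        embNorm ψ ω κ γ 1 ∞ ^ ((p₁⁻¹).toReal - (p₂⁻¹).toReal) *
        embNorm ψ ω κ γ 1 1 ^ (p₂⁻¹).toReal *
        embNorm ψ ω κ γ ∞ ∞ ^ (1 - (p₁⁻¹).toReal)) ∧
    (p₂ < p₁ →
      embNorm ψ ω κ γ p₁ p₂ ≤
        embNorm ψ ω κ γ ∞ 1 ^ ((p₂⁻¹).toReal - (p₁⁻¹).toReal) *
        embNorm ψ ω κ γ 1 1 ^ (p₁⁻¹).toReal *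
        embNorm ψ ω κ γ ∞ ∞ ^ (1 - (p₂⁻¹).toReal)) ∧
    (∀ c : Coord s → ℝ≥0, (∀ u, γ u = ∏ j ∈ u, c j) →
      embNorm ψ ω κ γ p₁ p₂ ≤
        ∏' j, ((1 + (c j : ℝ≥0∞) * kappaBarNorm ψ ω κ 1) ^ (p₁⁻¹).toReal *
          (1 + (c j : ℝ≥0∞) * kappaBarNorm ψ ω κ ∞) ^ (1 - (p₁⁻¹).toReal))) := by
  have := sigmaFinite_volume hD
  have hshift := isShift_centered hψ_meas hψ_pos hω_meas hω_nonneg hκ_meas hκ_anchor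
    (hκ_bar 1 le_rfl) (hκ_bar ∞ le_top)
  have hne := weightedVolume_ne_zero hψ_meas hψ_pos hω_one
  have hrows : ∀ p : ℝ≥0∞, 1 ≤ p → Admissible (Coord s) ψ κ p → ∀ x,
      MemLp (fun t => κ x t / ψ t) p.conjExponent (weightedVolume ψ) := fun p hp hκ x =>
    memLp_div_of_kappaHat hψ_meas hψ_pos hp (hκ_meas.comp measurable_prodMk_left)
      (hκ.kappaHat_lt_top x)
  set β : D → ℝ := fun t => (∫ y, κ y t * ω y) / ψ t
  set B := amp γ (gain (weightedVolume ψ) β 1)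
  set C := amp γ (gain (weightedVolume ψ) β ∞)
  set θ := (p₁⁻¹).toReal
  set φ := (p₂⁻¹).toReal
  have hθ0 : 0 ≤ θ := ENNReal.toReal_nonneg
  have hφ0 : 0 ≤ φ := ENNReal.toReal_nonneg
  have hθ1 : θ ≤ 1 := toReal_inv_le_one hp₁
  have hφ1 : φ ≤ 1 := toReal_inv_le_one hp₂
  have hθ1' : 0 ≤ 1 - θ := sub_nonneg.2 hθ1
  have hφ1' : 0 ≤ 1 - φ := sub_nonneg.2 hφ1
  have hamp : ∀ v u, amp γ (gain (weightedVolume ψ) β p₁) v u = B v u ^ θ * C v u ^ (1 - θ) :=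
    fun v u => by
      simp only [B, C, gain_one, gain_top]
      exact amp_interpolate _ _ hθ0 hθ1 v u
  have hBrow : rowSum B ≤ embNorm ψ ω κ γ 1 ∞ :=
    hshift.rowSum_amp_le hne hγ (Or.inl rfl) (hrows 1 le_rfl hκ_one) hκ_one
  have hBcol : colSum B ≤ embNorm ψ ω κ γ 1 1 :=
    hshift.colSum_amp_le hne hγ (Or.inl rfl) (hrows 1 le_rfl hκ_one) hκ_one
  have hCrow : rowSum C ≤ embNorm ψ ω κ γ ∞ ∞ :=
    hshift.rowSum_amp_le hne hγ (Or.inr rfl) (hrows ∞ le_top hκ_top) hκ_top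
  have hCcol : colSum C ≤ embNorm ψ ω κ γ ∞ 1 :=
    hshift.colSum_amp_le hne hγ (Or.inr rfl) (hrows ∞ le_top hκ_top) hκ_top
  -- The bounds are kept in terms of row and column sums, which are then estimated by endpoint norms
  -- or, for product weights, by infinite products.
  have hle : φ ≤ θ → embNorm ψ ω κ γ p₁ p₂ ≤
      rowSum B ^ (θ - φ) * colSum B ^ φ * rowSum C ^ (1 - θ) := fun h =>
    hshift.embeddingNorm_le hp₁ hp₂ (hrows p₁ hp₁ hκ_p₁) fun x => by
      change seqNorm p₂ (fun v => ∑' u, amp γ (gain (weightedVolume ψ) β p₁) v u * x u) ≤ _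
      simp only [hamp]
      exact seqNorm_matrix_le_of_le B C hp₂ hθ1 h x
  have hlt : θ < φ → embNorm ψ ω κ γ p₁ p₂ ≤
      colSum C ^ (φ - θ) * colSum B ^ θ * rowSum C ^ (1 - φ) := fun h =>
    hshift.embeddingNorm_le hp₁ hp₂ (hrows p₁ hp₁ hκ_p₁) fun x => by
      change seqNorm p₂ (fun v => ∑' u, amp γ (gain (weightedVolume ψ) β p₁) v u * x u) ≤ _
      simp only [hamp]
      exact seqNorm_matrix_le_of_lt B C hp₂ hθ0 h x
  have hinv : ∀ p : ℝ≥0∞, 1 ≤ p → p⁻¹ ≠ ∞ := fun p hp =>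
    ENNReal.inv_ne_top.2 (zero_lt_one.trans_le hp).ne'
  refine ⟨fun h => ?_, fun h => ?_, fun c hc => ?_⟩
  · have hφθ : φ ≤ θ := ENNReal.toReal_mono (hinv p₁ hp₁) (ENNReal.inv_le_inv.2 h)
    refine (hle hφθ).trans ?_
    have := sub_nonneg.2 hφθ
    gcongr
  · have hθφ : θ < φ := (ENNReal.toReal_lt_toReal (hinv p₁ hp₁) (hinv p₂ hp₂)).2
      (ENNReal.inv_lt_inv.2 h)
    refine (hlt hθφ).trans ?_
    have := sub_nonneg.2 hθφ.le
    gcongr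
  · set P : ℝ≥0∞ := ⨆ J : Finset (Coord s), ∏ j ∈ J, (1 + (c j : ℝ≥0∞) * kappaBarNorm ψ ω κ 1)
    set Q : ℝ≥0∞ := ⨆ J : Finset (Coord s), ∏ j ∈ J, (1 + (c j : ℝ≥0∞) * kappaBarNorm ψ ω κ ∞)
    have hgain1 : gain (weightedVolume ψ) β 1 ≤ kappaBarNorm ψ ω κ 1 :=
      (gain_one _ _).trans_le (eLpNorm_top_mean_div_le hψ_pos hω_nonneg)
    have hgain2 : gain (weightedVolume ψ) β ∞ ≤ kappaBarNorm ψ ω κ ∞ :=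
      (gain_top _ _).trans_le
        (eLpNorm_one_mean_div_le hψ_meas hψ_pos hω_nonneg hshift.measurable_shift)
    have hmono : ∀ m l : ℝ≥0∞, m ≤ l → ⨆ J : Finset (Coord s), ∏ j ∈ J, (1 + (c j : ℝ≥0∞) * m) ≤
        ⨆ J : Finset (Coord s), ∏ j ∈ J, (1 + (c j : ℝ≥0∞) * l) := fun m l h =>
      iSup_mono fun J => Finset.prod_le_prod' fun j _ => by gcongr
    have hBr : rowSum B ≤ P := (rowSum_amp_le_iSup hc _).trans (hmono _ _ hgain1)
    have hBc : colSum B ≤ P := (colSum_amp_le_iSup hc _).trans (hmono _ _ hgain1)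
    have hCr : rowSum C ≤ Q := (rowSum_amp_le_iSup hc _).trans (hmono _ _ hgain2)
    have hCc : colSum C ≤ Q := (colSum_amp_le_iSup hc _).trans (hmono _ _ hgain2)
    rw [← iSup_prod_rpow_mul (fun j => le_self_add) (fun j => le_self_add) hθ0 hθ1']
    -- In both cases the exponents of P add up to θ and those of Q to 1 - θ, so p₂ drops out.
    rcases le_or_gt φ θ with h | h
    · have h' := sub_nonneg.2 h
      calc embNorm ψ ω κ γ p₁ p₂ ≤ P ^ (θ - φ) * P ^ φ * Q ^ (1 - θ) := by
            refine (hle h).trans ?_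
            gcongr
        _ = P ^ θ * Q ^ (1 - θ) := by rw [← rpow_split P h' hφ0 (show θ = θ - φ + φ by ring)]
    · have h' := sub_nonneg.2 h.le
      calc embNorm ψ ω κ γ p₁ p₂ ≤ Q ^ (φ - θ) * P ^ θ * Q ^ (1 - φ) := by
            refine (hlt h).trans ?_
            gcongr
        _ = P ^ θ * Q ^ (1 - θ) := by
            rw [rpow_split Q h' hφ1' (show 1 - θ = φ - θ + (1 - φ) by ring)]
            ring
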